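/- **Theorem 4.3.** Let $k=\mathbb F_q$ be a finite field, $\bar k$ an algebraic closure of $k$, $\hat G=\mathrm{Gal}(\bar k/k)$ with its Krull topology, $\varphi\in\hat G$ the Frobenius $x\mapsto x^q$, and $G\subset\hat G$ the infinite cyclic subgroup generated by $\varphi$. For $m\ge 1$ let $mG\subset G$ be the subgroup generated by $\varphi^m$. Let $\gamma_*$ be the functor from $G$-modules to discrete $\hat G$-modules given by $$\gamma_*F=\operatorname{colim}_m F^{mG}=\bigcup_{m\ge1}F^{mG},$$ where $g\in\hat G$ acts on $F^{mG}$ as $\varphi^i$ if $g$ and $\varphi^i$ have the same restriction to $\mathbb F_{q^m}$. Let $R\gamma_*$ be its right derived functor on the bounded below derived category of $G$-modules. For an abelian group $A$ with trivial $G$-action, there is the canonical map $A=\gamma_*A\to R\gamma_*A$. Let $\hat G\cong\hat{\mathbb Z}$, $\varphi\mapsto1$, act on $N\otimes\mathbb Q/\mathbb Z=\mathbb Q/\mathbb Z\oplus\mathbb Q/\mathbb Z$ by $a\cdot(r,s)=(r+as,s)$. This is an extension of $\mathbb Q/\mathbb Z$ by $\mathbb Q/\mathbb Z$ (inclusion of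 the first summand, projection to the second). Let $0\to\mathbb Q/\mathbb Z\to M\to\mathbb Q\to0$ be its pull-back along the projection $\mathbb Q\to\mathbb Q/\mathbb Z$. Thus $M=\mathbb Q/\mathbb Z\oplus\mathbb Q$ with $a\cdot(r,t)=(r+a\bar t,t)$, where $\bar t$ is the class of $t$ in $\mathbb Q/\mathbb Z$. Let $\mathbb Z^c$ be the complex $\mathbb Q\to M$, with $\mathbb Q$ in degree $0$ and $M$ in degree $1$, whose differential is the composition $\mathbb Q\to\mathbb Q/\mathbb Z\to M$. The inclusion $\mathbb Z\subset\mathbb Q$ in degree $0$ and the projection $M\to\mathbb Q$ in degree $1$ define maps of complexes $\mathbb Z\to\mathbb Z^c\to\mathbb Q[-1]$. Let $e:\mathbb Q/\mathbb Z\to\mathbb Q/\mathbb Z[1]$ and $\beta:\mathbb Q/\mathbb Z\to\mathbb Z[1]$ be the connecting maps, in the derived category of discrete $\hat G$-modules, of the exact sequences $0\to\mathbb Q/\mathbb Z\to N\otimes\mathbb Q/\mathbb Z\to\mathbb Q/\mathbb Z\to0$ and $0\to\mathbb Z\to\mathbb Q\to\mathbb Q/\mathbb Z\to0$ respectively. Then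 there is an isomorphism $R\gamma_*\mathbb Z\cong\mathbb Z^c$ in the derived category of discrete $\hat G$-modules that is compatible with the maps from $\mathbb Z$, and such that, for the map $R\gamma_*\mathbb Z\cong\mathbb Z^c\to\mathbb Q[-1]$, the triangle $$\mathbb Z\to R\gamma_*\mathbb Z\to\mathbb Q[-1]\to\mathbb Z[1]$$ is distinguished with boundary map the composition $$\mathbb Q[-1]\to\mathbb Q/\mathbb Z[-1]\xrightarrow{\ e[-1]\ }\mathbb Q/\mathbb Z[0]\xrightarrow{\ \beta\ }\mathbb Z[1].$$ Moreover, $R\gamma_*\mathbb Q\cong\mathbb Q\oplus\mathbb Q[-1]$. -/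

import Mathlib

set_option linter.unusedSectionVars false

universe u v w₁ w₂

namespace WeilEtale

section Galois

variable (k : Type v) (K : Type u) [Field k] [Fintype k] [Field K] [Algebra k K]
  [IsAlgClosed K] [Algebra.IsAlgebraic k K]

/-- The Frobenius automorphism `x ↦ x ^ q` of `K` over `k`, where `q` is the cardinality of `k`. -/
noncomputable def frob : Gal(K/k) := FiniteField.frobeniusAlgEquivOfAlgebraic k K

/-- The subgroup of the Galois group that is generated by the Frobenius. -/
noncomputable abbrev WeilGroup : Subgroup Gal(K/k) := Subgroup.zpowers (frob k K)

/-- The Frobenius as an element of the group it generates. -/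
noncomputable def frobW : WeilGroup k K := ⟨frob k K, Subgroup.mem_zpowers _⟩

variable {k K}

/-- `g ≡ φ ^ i` modulo `m`: the automorphisms `g` and `φ ^ i` agree on the fixed field of `φ ^ m`,
which is the extension of degree `m` of `k` inside `K`. -/
def FrobCongr (g : Gal(K/k)) (m i : ℕ) : Prop :=
  ∀ x : K, (frob k K ^ m) x = x → g x = (frob k K ^ i) x

lemma frob_pow_apply (n : ℕ) (x : K) : (frob k K ^ n) x = x ^ (Fintype.card k ^ n) := by
  rw [AlgEquiv.coe_pow]
  exact congrFun (FiniteField.coe_frobeniusAlgEquivOfAlgebraic_iterate k K n) x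

lemma frob_pow_apply_of_fixed {n r : ℕ} (x : K) (hx : (frob k K ^ n) x = x) (a : ℕ) :
    (frob k K ^ (r + n * a)) x = (frob k K ^ r) x := by
  have h : ∀ a : ℕ, (frob k K ^ (n * a)) x = x := by
    intro a
    induction a with
    | zero => simp
    | succ a ih => rw [Nat.mul_succ, pow_add, AlgEquiv.mul_apply, hx, ih]
  rw [pow_add, AlgEquiv.mul_apply, h]

open Polynomial in
lemma fixed_eq_rootSet {m : ℕ} (hm : 0 < m) : {x : K | (frob k K ^ m) x = x} =
    (X ^ (Fintype.card k ^ m) - X : K[X]).rootSet K := by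
  have h1 : 1 < Fintype.card k ^ m := Nat.one_lt_pow hm.ne' Fintype.one_lt_card
  have hp : (X ^ (Fintype.card k ^ m) - X : K[X]) ≠ 0 := FiniteField.X_pow_card_sub_X_ne_zero K h1
  ext x
  rw [Set.mem_ofPred_eq, frob_pow_apply, mem_rootSet_of_ne hp]
  simp [sub_eq_zero]

lemma finite_fixed {m : ℕ} (hm : 0 < m) : {x : K | (frob k K ^ m) x = x}.Finite := by
  rw [fixed_eq_rootSet hm]
  exact Polynomial.rootSet_finite _ _

open Polynomial in
lemma card_fixed {m : ℕ} (hm : 0 < m) :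
    {x : K | (frob k K ^ m) x = x}.ncard = Fintype.card k ^ m := by
  have h1 : 1 < Fintype.card k ^ m := Nat.one_lt_pow hm.ne' Fintype.one_lt_card
  obtain ⟨p, hpk, n, hp, hc⟩ := FiniteField.card' k
  have : CharP K p := charP_of_injective_algebraMap (algebraMap k K).injective p
  have hdvd : p ∣ Fintype.card k ^ m := by
    rw [hc]
    exact (dvd_pow_self p n.ne_zero).trans (dvd_pow_self _ hm.ne')
  rw [fixed_eq_rootSet hm, ← Nat.card_coe_set_eq, Nat.card_eq_fintype_card,
    card_rootSet_eq_natDegree (galois_poly_separable p _ hdvd) (IsAlgClosed.splits _),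
    FiniteField.X_pow_card_sub_X_natDegree_eq K h1]

/-- The residue class of the exponent is unique. -/
lemma FrobCongr.modEq {g : Gal(K/k)} {m i j : ℕ} (hm : 0 < m)
    (hi : FrobCongr g m i) (hj : FrobCongr g m j) : i ≡ j [MOD m] := by
  wlog hij : i ≤ j generalizing i j
  · exact (this hj hi (le_of_not_ge hij)).symm
  obtain ⟨r, rfl⟩ := Nat.exists_eq_add_of_le hij
  have hr : ∀ x : K, (frob k K ^ m) x = x → (frob k K ^ (r % m)) x = x := by
    intro x hx
    have h := (hi x hx).symm.trans (hj x hx)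
    rw [pow_add, AlgEquiv.mul_apply] at h
    have h := ((frob k K ^ i).injective h).symm
    rwa [← Nat.mod_add_div r m, frob_pow_apply_of_fixed x hx] at h
  rcases Nat.eq_zero_or_pos (r % m) with h0 | h0
  · exact ((Nat.modEq_zero_iff_dvd.2 (Nat.dvd_of_mod_eq_zero h0)).add_left i).symm
  · exfalso
    have h := Set.ncard_le_ncard (s := {x : K | (frob k K ^ m) x = x})
      (t := {x : K | (frob k K ^ (r % m)) x = x}) hr (finite_fixed h0)
    rw [card_fixed hm, card_fixed h0] at h
    exact absurd h (not_le.2 (Nat.pow_lt_pow_right Fintype.one_lt_card (Nat.mod_lt r hm)))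

lemma FrobCongr.mono {g : Gal(K/k)} {m d i : ℕ} (h : FrobCongr g m i) (hd : d ∣ m) :
    FrobCongr g d i := by
  obtain ⟨a, rfl⟩ := hd
  intro x hx
  refine h x ?_
  simpa using frob_pow_apply_of_fixed (r := 0) x hx a

lemma FrobCongr.mul {g h : Gal(K/k)} {m i j : ℕ} (hg : FrobCongr g m i) (hh : FrobCongr h m j) :
    FrobCongr (g * h) m (i + j) := by
  intro x hx
  rw [AlgEquiv.mul_apply, hh x hx, pow_add, AlgEquiv.mul_apply]
  refine hg _ ?_
  rw [← AlgEquiv.mul_apply, ← pow_add, add_comm, pow_add, AlgEquiv.mul_apply, hx]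

lemma frobCongr_one (m : ℕ) : FrobCongr (1 : Gal(K/k)) m 0 := fun x _ => by simp

lemma frobCongr_pow (m i : ℕ) : FrobCongr (frob k K ^ i) m i := fun _ _ => rfl

/-- The finite extension of `k` generated by the elements fixed by `φ ^ m`. -/
def fixedExt (k : Type v) (K : Type u) [Field k] [Fintype k] [Field K] [Algebra k K]
    [IsAlgClosed K] [Algebra.IsAlgebraic k K] (m : ℕ) : IntermediateField k K :=
  IntermediateField.adjoin k {x : K | (frob k K ^ m) x = x}

lemma finiteDimensional_fixedExt {m : ℕ} (hm : 0 < m) :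
    FiniteDimensional k (fixedExt k K m) := by
  have := (finite_fixed (k := k) (K := K) hm).to_subtype
  exact IntermediateField.finiteDimensional_adjoin
    fun x _ => Algebra.IsIntegral.isIntegral x

/-- Every element of the Galois group is congruent to a power of the Frobenius modulo every
positive integer. -/
lemma exists_frobCongr (g : Gal(K/k)) {m : ℕ} (hm : 0 < m) : ∃ i, FrobCongr g m i := by
  have := finiteDimensional_fixedExt (k := k) (K := K) hm
  have : Finite (fixedExt k K m) := Module.finite_of_finite k
  obtain ⟨n, hn⟩ := (FiniteField.bijective_frobeniusAlgEquivOfAlgebraic_pow k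
    (fixedExt k K m)).2 (g.restrictNormal (fixedExt k K m))
  refine ⟨n, fun x hx => ?_⟩
  have h := g.restrictNormal_commutes (fixedExt k K m)
    ⟨x, IntermediateField.subset_adjoin _ _ hx⟩
  rw [← hn] at h
  rw [frob_pow_apply]
  simp only [AlgEquiv.coe_pow] at h
  rw [FiniteField.coe_frobeniusAlgEquivOfAlgebraic_iterate] at h
  simpa using h.symm

/-- For a positive integer `m`, the set of all `g ≡ h` modulo `m` is open. -/
lemma eventually_frobCongr {m : ℕ} (hm : 0 < m) (g : Gal(K/k)) {i : ℕ} (hi : FrobCongr g m i) :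
    ∀ᶠ h in nhds g, FrobCongr h m i := by
  have := finiteDimensional_fixedExt (k := k) (K := K) hm
  have ho := (IntermediateField.fixingSubgroup_isOpen (fixedExt k K m)).leftCoset g
  refine Filter.mem_of_superset (ho.mem_nhds ⟨1, one_mem _, by simp⟩) ?_
  rintro _ ⟨h, hh, rfl⟩ x hx
  have : h x = x := (IntermediateField.mem_fixingSubgroup_iff _ _).1 hh x
    (IntermediateField.subset_adjoin _ _ hx)
  simp only [smul_eq_mul, AlgEquiv.mul_apply, this]
  exact hi x hx

open CategoryTheory Limits

/-- A module over a group `Γ` from an action on an abelian group by additive maps. -/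
def mkMod {Γ : Type*} [Group Γ] (A : Type) [AddCommGroup A] (ρ : Γ →* AddMonoid.End A) :
    Action AddCommGrpCat.{0} Γ where
  V := AddCommGrpCat.of A
  ρ :=
    { toFun g := AddCommGrpCat.ofHom (ρ g)
      map_one' := by rw [map_one]; rfl
      map_mul' g h := by rw [map_mul]; rfl }

/-- The additive map by which an element of the group acts on a module. -/
def act {Γ : Type*} [Group Γ] (V : Action AddCommGrpCat.{0} Γ) (g : Γ) : V.V →+ V.V :=
  AddCommGrpCat.Hom.hom (V.ρ g)

section act

variable {Γ : Type*} [Group Γ] (V : Action AddCommGrpCat.{0} Γ)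

@[simp] lemma act_one (x : V.V) : act V 1 x = x := by
  unfold act; rw [map_one]; rfl

lemma act_mul (g h : Γ) (x : V.V) : act V (g * h) x = act V g (act V h x) := by
  unfold act; rw [map_mul]; rfl

lemma hom_act {V W : Action AddCommGrpCat.{0} Γ} (f : V ⟶ W) (g : Γ) (x : V.V) :
    f.hom (act V g x) = act W g (f.hom x) :=
  ConcreteCategory.congr_hom (f.comm g) x

@[simp] lemma act_mkMod (A : Type) [AddCommGroup A] (ρ : Γ →* AddMonoid.End A) (g : Γ) (x : A) :
    act (mkMod A ρ) g x = ρ g x := rfl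

/-- A morphism of modules from an equivariant additive map. -/
def mkHom {V W : Action AddCommGrpCat.{0} Γ} (f : V.V →+ W.V)
    (hf : ∀ g x, f (act V g x) = act W g (f x)) : V ⟶ W where
  hom := AddCommGrpCat.ofHom f
  comm g := by ext x; exact hf g x

end act

variable (k K)

/-- The category of `G`-modules, for the group `G` generated by the Frobenius. -/
abbrev GMod := Action AddCommGrpCat.{0} (WeilGroup k K)

instance : Countable (WeilGroup k K) :=
  Function.Surjective.countable (f := fun n : ℤ => (frobW k K) ^ n) (by
    rintro ⟨_, n, rfl⟩
    exact ⟨n, Subtype.ext (by simp [frobW])⟩)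

instance : Countable (MonoidAlgebra ℤ (WeilGroup k K)) :=
  (MonoidAlgebra.coeff_injective (R := ℤ) (M := WeilGroup k K)).countable

instance : EnoughInjectives (GMod k K) :=
  EnoughInjectives.of_equivalence
    (((forget₂ (ModuleCat.{0} ℤ) AddCommGrpCat.{0}).asEquivalence.symm.mapAction
        (WeilGroup k K)).functor ⋙
      Rep.ActionToRep ℤ (WeilGroup k K) ⋙ Rep.equivalenceModuleMonoidAlgebra.functor)

/-- A module over the Galois group is discrete if the stabilizer of every element is open, i.e. if
the action is continuous for the discrete topology on the module. -/
def isDiscrete : ObjectProperty (Action AddCommGrpCat.{0} Gal(K/k)) :=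
  fun V => ∀ x : V.V, IsOpen {g : Gal(K/k) | act V g x = x}

variable {k K} in
lemma isDiscrete_iff (V : Action AddCommGrpCat.{0} Gal(K/k)) :
    isDiscrete k K V ↔ ∀ x : V.V, ∀ᶠ g in nhds (1 : Gal(K/k)), act V g x = x := by
  refine forall_congr' fun x => ⟨fun h => h.mem_nhds (by simp), fun h => ?_⟩
  rw [isOpen_iff_mem_nhds]
  intro g hg
  have hg : act V g x = x := hg
  have h2 := (continuous_const_smul (g⁻¹ : Gal(K/k))).tendsto g
  rw [smul_eq_mul, inv_mul_cancel] at h2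
  filter_upwards [h2.eventually h] with a ha
  have h3 := congrArg (act V g) ha
  rwa [← act_mul, smul_eq_mul, mul_inv_cancel_left, hg] at h3

instance : (isDiscrete k K).IsClosedUnderSubobjects where
  prop_of_mono {X Y} f _ hY := by
    rw [isDiscrete_iff] at hY ⊢
    intro x
    filter_upwards [hY (f.hom x)] with g hg
    have : Mono f.hom := inferInstanceAs (Mono ((Action.forget _ _).map f))
    apply (AddCommGrpCat.mono_iff_injective f.hom).1 this
    rw [hom_act, hg]

instance : (isDiscrete k K).IsClosedUnderQuotients where
  prop_of_epi {X Y} f _ hX := by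
    rw [isDiscrete_iff] at hX ⊢
    intro y
    have : Epi f.hom := inferInstanceAs (Epi ((Action.forget _ _).map f))
    obtain ⟨x, rfl⟩ := (AddCommGrpCat.epi_iff_surjective f.hom).1 this y
    filter_upwards [hX x] with g hg
    rw [← hom_act, hg]

instance : (isDiscrete k K).IsClosedUnderFiniteProducts where
  isClosedUnderLimitsOfShape J _ :=
    { limitsOfShape_le := by
        rintro X ⟨p⟩
        rw [isDiscrete_iff]
        intro x
        have h : ∀ j, ∀ᶠ g in nhds (1 : Gal(K/k)),
            act (p.diag.obj j) g ((p.π.app j).hom x) = (p.π.app j).hom x :=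
          fun j => (isDiscrete_iff _).1 (p.prop_diag_obj j) _
        have : Finite (Discrete J) := Finite.of_equiv J discreteEquiv.symm
        filter_upwards [Filter.eventually_all.2 h] with g hg
        refine Concrete.isLimit_ext _
          (isLimitOfPreserves (Action.forget AddCommGrpCat.{0} Gal(K/k)) p.isLimit) _ _
          fun j => ?_
        refine Eq.trans ?_ (hg j)
        exact hom_act (p.π.app j) g x }

instance : (isDiscrete k K).ContainsZero where
  exists_zero := by
    obtain ⟨Z, hZ⟩ := (inferInstance : HasZeroObject (Action AddCommGrpCat.{0} Gal(K/k)))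
    refine ⟨Z, hZ, (isDiscrete_iff Z).2 fun x => Filter.Eventually.of_forall fun g => ?_⟩
    have : Subsingleton Z.V := AddCommGrpCat.subsingleton_of_isZero
      ((Action.forget AddCommGrpCat.{0} Gal(K/k)).map_isZero hZ)
    exact Subsingleton.elim (α := Z.V) _ _

/-- The category of discrete (continuous) modules over the Galois group. -/
abbrev DiscMod := (isDiscrete k K).FullSubcategory

variable {k K}

/-- The power of the Frobenius by which `g` acts modulo `m`. -/
noncomputable def frobExp (g : Gal(K/k)) (m : ℕ) : ℕ :=
  if h : 0 < m then (exists_frobCongr g h).choose else 0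

lemma frobCongr_frobExp (g : Gal(K/k)) {m : ℕ} (hm : 0 < m) : FrobCongr g m (frobExp g m) := by
  rw [frobExp, dif_pos hm]
  exact (exists_frobCongr g hm).choose_spec

section gammaStar

variable (F : GMod k K)

lemma act_frob_pow_add_mul {x : F.V} {d : ℕ} (hd : act F (frobW k K ^ d) x = x) (r a : ℕ) :
    act F (frobW k K ^ (r + d * a)) x = act F (frobW k K ^ r) x := by
  have h : ∀ a : ℕ, act F (frobW k K ^ (d * a)) x = x := by
    intro a
    induction a with
    | zero => simp
    | succ a ih => rw [Nat.mul_succ, pow_add, act_mul, hd, ih]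
  rw [pow_add, act_mul, h]

lemma act_frob_pow_of_modEq {x : F.V} {d i j : ℕ} (hd : act F (frobW k K ^ d) x = x)
    (hij : i ≡ j [MOD d]) : act F (frobW k K ^ i) x = act F (frobW k K ^ j) x := by
  rw [← Nat.mod_add_div i d, ← Nat.mod_add_div j d, act_frob_pow_add_mul F hd,
    act_frob_pow_add_mul F hd, hij]

lemma act_frob_pow_gcd {x : F.V} {m n : ℕ} (hm : act F (frobW k K ^ m) x = x)
    (hn : act F (frobW k K ^ n) x = x) : act F (frobW k K ^ (m.gcd n)) x = x := by
  have key : ∀ r : ℕ, act F (frobW k K ^ r) x = x ↔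
      Function.IsPeriodicPt (act F (frobW k K)) r x := by
    intro r
    have : ∀ r : ℕ, act F (frobW k K ^ r) x = (act F (frobW k K))^[r] x := by
      intro r
      induction r with
      | zero => simp
      | succ r ih => rw [pow_succ', act_mul, ih, Function.iterate_succ_apply']
    rw [this]; rfl
  rw [key] at *
  exact hm.gcd hn

/-- The action of the Galois group does not depend on the choices. -/
lemma act_frob_pow_congr {x : F.V} {g : Gal(K/k)} {m n i j : ℕ} (hm0 : 0 < m)
    (hm : act F (frobW k K ^ m) x = x) (hn : act F (frobW k K ^ n) x = x)
    (hi : FrobCongr g m i) (hj : FrobCongr g n j) :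
    act F (frobW k K ^ i) x = act F (frobW k K ^ j) x :=
  act_frob_pow_of_modEq F (act_frob_pow_gcd F hm hn)
    ((hi.mono (Nat.gcd_dvd_left m n)).modEq (Nat.gcd_pos_of_pos_left n hm0)
      (hj.mono (Nat.gcd_dvd_right m n)))

/-- The union of the subgroups `F ^ (mG)` of elements fixed by `φ ^ m`, for `m ≥ 1`. -/
def finPart : AddSubgroup F.V where
  carrier := {x | ∃ m : ℕ, 0 < m ∧ act F (frobW k K ^ m) x = x}
  zero_mem' := ⟨1, one_pos, map_zero _⟩
  add_mem' := by
    rintro x y ⟨m, hm, hx⟩ ⟨n, hn, hy⟩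
    have hx' := act_frob_pow_add_mul F hx 0 n
    have hy' := act_frob_pow_add_mul F hy 0 m
    rw [mul_comm n m] at hy'
    refine ⟨m * n, Nat.mul_pos hm hn, ?_⟩
    simp only [zero_add, pow_zero, act_one] at hx' hy'
    rw [map_add, hx', hy']
  neg_mem' := by
    rintro x ⟨m, hm, hx⟩
    exact ⟨m, hm, by rw [map_neg, hx]⟩

/-- A positive integer `m` such that `x` is fixed by `φ ^ m`. -/
noncomputable def period (x : finPart F) : ℕ := x.2.choose

lemma period_pos (x : finPart F) : 0 < period F x := x.2.choose_spec.1

lemma act_period (x : finPart F) : act F (frobW k K ^ period F x) (x : F.V) = x :=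
  x.2.choose_spec.2

lemma act_frob_mem (i : ℕ) (x : finPart F) : act F (frobW k K ^ i) (x : F.V) ∈ finPart F := by
  refine ⟨period F x, period_pos F x, ?_⟩
  rw [← act_mul, ← pow_add, add_comm, pow_add, act_mul, act_period]

/-- The action of `g` in the Galois group on `⋃ F ^ (mG)`: if `x` is fixed by `φ ^ m` and
`g ≡ φ ^ i` modulo `m`, then `g` sends `x` to `φ ^ i x`. -/
noncomputable def galAct (g : Gal(K/k)) (x : finPart F) : finPart F :=
  ⟨act F (frobW k K ^ frobExp g (period F x)) (x : F.V), act_frob_mem F _ x⟩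

lemma galAct_eq {g : Gal(K/k)} {x : finPart F} {m i : ℕ} (_hm : 0 < m)
    (hx : act F (frobW k K ^ m) (x : F.V) = x) (hi : FrobCongr g m i) :
    (galAct F g x : F.V) = act F (frobW k K ^ i) (x : F.V) :=
  act_frob_pow_congr F (period_pos F x) (act_period F x) hx
    (frobCongr_frobExp g (period_pos F x)) hi

lemma galAct_add (g : Gal(K/k)) (x y : finPart F) :
    galAct F g (x + y) = galAct F g x + galAct F g y := by
  have hx := act_frob_pow_add_mul F (act_period F x) 0 (period F y)
  have hy := act_frob_pow_add_mul F (act_period F y) 0 (period F x)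
  rw [mul_comm (period F y)] at hy
  simp only [zero_add, pow_zero, act_one] at hx hy
  have hm := Nat.mul_pos (period_pos F x) (period_pos F y)
  have hg := frobCongr_frobExp g hm
  ext
  rw [AddSubgroup.coe_add, galAct_eq F hm hx hg, galAct_eq F hm hy hg,
    galAct_eq F hm (by rw [AddSubgroup.coe_add, map_add, hx, hy]) hg, AddSubgroup.coe_add, map_add]

/-- The action of the Galois group on `⋃ F ^ (mG)`. -/
noncomputable def galActHom : Gal(K/k) →* AddMonoid.End (finPart F) where
  toFun g := AddMonoidHom.mk' (galAct F g) (galAct_add F g)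
  map_one' := by
    ext x
    refine (galAct_eq F (period_pos F x) (act_period F x) (frobCongr_one _)).trans ?_
    simp
  map_mul' g h := by
    ext x
    have hm := period_pos F x
    have hx := act_period F x
    have hg := frobCongr_frobExp g hm
    have hh := frobCongr_frobExp h hm
    have h1 := galAct_eq F hm hx hh
    have hx' : act F (frobW k K ^ period F x) (galAct F h x : F.V) = galAct F h x := by
      rw [h1, ← act_mul, ← pow_add, add_comm, pow_add, act_mul, hx]
    refine (galAct_eq F hm hx (hg.mul hh)).trans ?_
    refine Eq.trans ?_ (galAct_eq F hm hx' hg).symm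
    rw [h1, pow_add, act_mul]

lemma isDiscrete_gammaStar : isDiscrete k K (mkMod (finPart F) (galActHom F)) := by
  rw [isDiscrete_iff]
  intro x
  filter_upwards [eventually_frobCongr (period_pos F x) 1 (frobCongr_one _)] with g hg
  refine Subtype.ext ((galAct_eq F (period_pos F x) (act_period F x) hg).trans ?_)
  simp

variable {F} in
/-- The map induced on `⋃ F ^ (mG)` by a homomorphism of `G`-modules. -/
def finPartMap {F' : GMod k K} (f : F ⟶ F') : finPart F →+ finPart F' :=
  AddMonoidHom.codRestrict (f.hom.hom.comp (finPart F).subtype) (finPart F') (by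
    rintro ⟨x, m, hm, hx⟩
    exact ⟨m, hm, (hom_act f _ x).symm.trans (congrArg f.hom hx)⟩)

variable {F} in
lemma finPartMap_galAct {F' : GMod k K} (f : F ⟶ F') (g : Gal(K/k)) (x : finPart F) :
    finPartMap f (galAct F g x) = galAct F' g (finPartMap f x) := by
  refine Subtype.ext ?_
  refine (hom_act f _ _).trans ?_
  have h : act F' (frobW k K ^ period F x) (f.hom (x : F.V)) = f.hom (x : F.V) := by
    rw [← hom_act, act_period]
  exact (galAct_eq F' (x := finPartMap f x) (period_pos F x) h
    (frobCongr_frobExp g (period_pos F x))).symm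

end gammaStar

variable (k K)

/-- The functor `γ_*` from `G`-modules to discrete modules over the Galois group, which sends `F`
to the colimit (here: the union) of the `F ^ H`, for `H = mG` the subgroups of finite index. -/
noncomputable def gammaStar : GMod k K ⥤ DiscMod k K where
  obj F := ⟨mkMod (finPart F) (galActHom F), isDiscrete_gammaStar F⟩
  map f := ObjectProperty.homMk (mkHom (finPartMap f) (finPartMap_galAct f))
  map_id _ := rfl
  map_comp _ _ := rfl

instance : (gammaStar k K).Additive where
  map_add := rfl

/-- An abelian group as a `G`-module with trivial action. -/
noncomputable abbrev constG (A : Type) [AddCommGroup A] : GMod k K :=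
  Action.trivial (WeilGroup k K) (AddCommGrpCat.of A)

/-- An abelian group as a discrete module over the Galois group, with trivial action. -/
def const (A : Type) [AddCommGroup A] : DiscMod k K :=
  ⟨Action.trivial Gal(K/k) (AddCommGrpCat.of A),
    (isDiscrete_iff _).2 fun _ => Filter.Eventually.of_forall fun _ => rfl⟩

/-- A homomorphism of abelian groups as a homomorphism of modules with trivial action. -/
def constMap {A B : Type} [AddCommGroup A] [AddCommGroup B] (f : A →+ B) :
    const k K A ⟶ const k K B :=
  ObjectProperty.homMk (mkHom f fun _ _ => rfl)

/-- The canonical map `A ⟶ γ_* A` for a module `A` with trivial action. -/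
noncomputable def constUnit (A : Type) [AddCommGroup A] :
    const k K A ⟶ (gammaStar k K).obj (constG k K A) :=
  ObjectProperty.homMk (mkHom
    (AddMonoidHom.codRestrict (AddMonoidHom.id A) (finPart (constG k K A))
      fun _ => ⟨1, one_pos, rfl⟩)
    fun _ _ => Subtype.ext rfl)

/-- The group `ℚ/ℤ`. -/
abbrev QZ : Type := AddCircle (1 : ℚ)

/-- The projection from `ℚ` to `ℚ/ℤ`. -/
def projQZ : ℚ →+ QZ := QuotientAddGroup.mk' _

lemma QZ.exists_nsmul_eq_zero (s : QZ) : ∃ m : ℕ, 0 < m ∧ m • s = 0 := by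
  induction s using QuotientAddGroup.induction_on with
  | H x =>
    refine ⟨x.den, x.den_pos, ?_⟩
    rw [← AddCircle.coe_nsmul, AddCircle.coe_eq_zero_iff]
    exact ⟨x.num, by simp [Rat.den_mul_eq_num]⟩

variable {k K}

/-- The additive action of the Galois group on `ℚ/ℤ`: if `m • s = 0` and `g ≡ φ ^ i` modulo `m`,
then `galSMul g s = i • s`. So the power `φ ^ a` of the Frobenius acts as multiplication by `a`. -/
noncomputable def galSMul (g : Gal(K/k)) (s : QZ) : QZ := frobExp g (addOrderOf s) • s

lemma galSMul_eq {g : Gal(K/k)} {s : QZ} {m i : ℕ} (hm : 0 < m) (hs : m • s = 0)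
    (hi : FrobCongr g m i) : galSMul g s = i • s := by
  have hd : addOrderOf s ∣ m := addOrderOf_dvd_of_nsmul_eq_zero hs
  have h0 : 0 < addOrderOf s := Nat.pos_of_dvd_of_pos hd hm
  exact nsmul_eq_nsmul_iff_modEq.2 ((frobCongr_frobExp g h0).modEq h0 (hi.mono hd))

lemma galSMul_add (g : Gal(K/k)) (s t : QZ) : galSMul g (s + t) = galSMul g s + galSMul g t := by
  obtain ⟨m, hm, hs⟩ := QZ.exists_nsmul_eq_zero s
  obtain ⟨n, hn, ht⟩ := QZ.exists_nsmul_eq_zero t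
  have hmn := Nat.mul_pos hm hn
  have hg := frobCongr_frobExp g hmn
  have hs' : (m * n) • s = 0 := by rw [mul_nsmul, hs, nsmul_zero]
  have ht' : (m * n) • t = 0 := by rw [mul_nsmul', ht, nsmul_zero]
  rw [galSMul_eq hmn hs' hg, galSMul_eq hmn ht' hg,
    galSMul_eq hmn (by rw [nsmul_add, hs', ht', add_zero]) hg, nsmul_add]

lemma galSMul_one (s : QZ) : galSMul (1 : Gal(K/k)) s = 0 := by
  obtain ⟨m, hm, hs⟩ := QZ.exists_nsmul_eq_zero s
  rw [galSMul_eq hm hs (frobCongr_one m), zero_nsmul]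

lemma galSMul_mul (g h : Gal(K/k)) (s : QZ) : galSMul (g * h) s = galSMul g s + galSMul h s := by
  obtain ⟨m, hm, hs⟩ := QZ.exists_nsmul_eq_zero s
  have hg := frobCongr_frobExp g hm
  have hh := frobCongr_frobExp h hm
  rw [galSMul_eq hm hs hg, galSMul_eq hm hs hh, galSMul_eq hm hs (hg.mul hh), add_nsmul]

variable (k K)

section extension

variable {B : Type} [AddCommGroup B] (p : B →+ QZ)

/-- The action of the Galois group on `ℚ/ℤ × B` by `g (r, b) = (r + g · p b, b)`, where `·` is the
additive action on `ℚ/ℤ`. -/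
noncomputable def extAct : Gal(K/k) →* AddMonoid.End (QZ × B) where
  toFun g := AddMonoidHom.mk' (fun x => (x.1 + galSMul g (p x.2), x.2)) (by
    rintro ⟨r, b⟩ ⟨r', b'⟩
    simp only [Prod.mk_add_mk, map_add, galSMul_add]
    exact Prod.ext (add_add_add_comm _ _ _ _) rfl)
  map_one' := by
    refine AddMonoidHom.ext fun x => Prod.ext ?_ rfl
    change x.1 + galSMul 1 (p x.2) = x.1
    rw [galSMul_one, add_zero]
  map_mul' g h := by
    refine AddMonoidHom.ext fun x => Prod.ext ?_ rfl
    change x.1 + galSMul (g * h) (p x.2) = x.1 + galSMul h (p x.2) + galSMul g (p x.2)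
    rw [galSMul_mul]
    abel

/-- The module `ℚ/ℤ × B` with the action `g (r, b) = (r + g · p b, b)`. It is the pull-back of the
extension `0 → ℚ/ℤ → N ⊗ ℚ/ℤ → ℚ/ℤ → 0` along `p : B → ℚ/ℤ`. -/
noncomputable def extMod : DiscMod k K :=
  ⟨mkMod (QZ × B) (extAct k K p), by
    rw [isDiscrete_iff]
    rintro ⟨r, b⟩
    obtain ⟨m, hm, hs⟩ := QZ.exists_nsmul_eq_zero (p b)
    filter_upwards [eventually_frobCongr hm 1 (frobCongr_one _)] with g hg
    refine Prod.ext ?_ rfl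
    change r + galSMul g (p b) = r
    rw [galSMul_eq hm hs hg, zero_nsmul, add_zero]⟩

lemma extAct_inl (g : Gal(K/k)) (x : QZ) : extAct k K p g (x, 0) = (x, 0) := by
  refine Prod.ext ?_ rfl
  change x + galSMul g (p 0) = x
  rw [map_zero, galSMul_eq one_pos (nsmul_zero 1) (frobCongr_frobExp g one_pos), nsmul_zero,
    add_zero]

/-- The inclusion of `ℚ/ℤ` in the extension. -/
noncomputable def extIncl : const k K QZ ⟶ extMod k K p :=
  ObjectProperty.homMk (mkHom (AddMonoidHom.inl QZ B) fun g x => (extAct_inl k K p g x).symm)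

/-- The projection from the extension to `B`. -/
noncomputable def extProj : extMod k K p ⟶ const k K B :=
  ObjectProperty.homMk (mkHom (AddMonoidHom.snd QZ B) fun _ _ => rfl)

/-- The extension `0 → ℚ/ℤ → ℚ/ℤ × B → B → 0`. -/
noncomputable def extSeq : ShortComplex (DiscMod k K) :=
  ShortComplex.mk (extIncl k K p) (extProj k K p) rfl

end extension

/-- The forgetful functor from discrete modules to abelian groups. -/
abbrev forgetDisc : DiscMod k K ⥤ AddCommGrpCat.{0} := (isDiscrete k K).ι ⋙ Action.forget _ _

lemma shortExact_of_forget (S : ShortComplex (DiscMod k K))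
    (h₁ : Function.Injective ((forgetDisc k K).map S.f))
    (h₂ : Function.Exact ((forgetDisc k K).map S.f) ((forgetDisc k K).map S.g))
    (h₃ : Function.Surjective ((forgetDisc k K).map S.g)) : S.ShortExact := by
  refine ShortExact.reflects_shortExact_of_faithful (forgetDisc k K) ?_
  exact { exact := (ShortComplex.ab_exact_iff_function_exact _).2 h₂
          mono_f := (AddCommGrpCat.mono_iff_injective _).2 h₁
          epi_g := (AddCommGrpCat.epi_iff_surjective _).2 h₃ }

lemma extSeq_shortExact {B : Type} [AddCommGroup B] (p : B →+ QZ) : (extSeq k K p).ShortExact :=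
  shortExact_of_forget k K _ (fun _ _ h => congrArg Prod.fst h)
    (fun x => ⟨fun h => ⟨x.1, Prod.ext rfl h.symm⟩, by rintro ⟨y, rfl⟩; rfl⟩)
    (fun b => ⟨(0, b), rfl⟩)

lemma projQZ_eq_zero_iff (x : ℚ) : projQZ x = 0 ↔ ∃ n : ℤ, (n : ℚ) = x := by
  change ((x : ℚ) : QZ) = 0 ↔ _
  rw [AddCircle.coe_eq_zero_iff]
  simp

/-- The sequence `0 → ℤ → ℚ → ℚ/ℤ → 0` of modules with trivial action. -/
noncomputable def bocksteinSeq : ShortComplex (DiscMod k K) :=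
  ShortComplex.mk (constMap k K (Int.castAddHom ℚ)) (constMap k K projQZ) (by
    refine ObjectProperty.hom_ext _ (Action.hom_ext _ _ ?_)
    refine AddCommGrpCat.hom_ext (AddMonoidHom.ext fun n => ?_)
    exact (projQZ_eq_zero_iff _).2 ⟨n, rfl⟩)

lemma bocksteinSeq_shortExact : (bocksteinSeq k K).ShortExact :=
  shortExact_of_forget k K _ (fun _ _ h => Int.cast_injective (α := ℚ) h)
    (fun x => projQZ_eq_zero_iff x)
    (fun s => QuotientAddGroup.mk_surjective s)

/-- The extension `M` of `ℚ` by `ℚ/ℤ`: the pull-back along `ℚ → ℚ/ℤ` of the extension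
`N ⊗ ℚ/ℤ` of `ℚ/ℤ` by `ℚ/ℤ`. -/
noncomputable abbrev modM : DiscMod k K := extMod k K projQZ

/-- The map `ℚ → ℚ/ℤ → M`. -/
noncomputable def mapQM : const k K ℚ ⟶ modM k K := constMap k K projQZ ≫ extIncl k K projQZ

lemma rel_zero_one : (ComplexShape.up ℤ).Rel 0 1 := zero_add 1

/-- The complex `ℤᶜ`: the map `ℚ → M`, with `ℚ` in degree `0` and `M` in degree `1`. -/
noncomputable abbrev Zc : CochainComplex (DiscMod k K) ℤ :=
  HomologicalComplex.double (mapQM k K) rel_zero_one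

/-- The morphism of complexes `ℤ → ℤᶜ` given by the inclusion of `ℤ` in `ℚ`. -/
noncomputable def toZc :
    (CochainComplex.singleFunctor (DiscMod k K) 0).obj (const k K ℤ) ⟶ Zc k K :=
  HomologicalComplex.mkHomFromSingle
    (constMap k K (Int.castAddHom ℚ) ≫ (HomologicalComplex.doubleXIso₀ (mapQM k K) rel_zero_one).inv) (by
      rintro i rfl
      have h : constMap k K (Int.castAddHom ℚ) ≫ mapQM k K = 0 := by
        rw [mapQM, ← Category.assoc]
        exact (congrArg (· ≫ extIncl k K projQZ) (bocksteinSeq k K).zero).trans zero_comp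
      change _ ≫ (HomologicalComplex.double (mapQM k K) rel_zero_one).d 0 1 = 0
      rw [HomologicalComplex.double_d _ _ zero_ne_one, Category.assoc, Iso.inv_hom_id_assoc,
        reassoc_of% h, zero_comp])

/-- The morphism of complexes `ℤᶜ → ℚ[-1]` given by the projection `M → ℚ` in degree `1`. -/
noncomputable def fromZc :
    Zc k K ⟶ (CochainComplex.singleFunctor (DiscMod k K) 1).obj (const k K ℚ) :=
  HomologicalComplex.mkHomToSingle
    ((HomologicalComplex.doubleXIso₁ (mapQM k K) rel_zero_one zero_ne_one).hom ≫ extProj k K projQZ) (by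
      intro i hi
      obtain rfl : i = 0 := add_right_cancel (hi.trans (zero_add 1).symm)
      have h : mapQM k K ≫ extProj k K projQZ = 0 := by
        rw [mapQM, Category.assoc]
        exact (congrArg (constMap k K projQZ ≫ ·) (extSeq k K projQZ).zero).trans comp_zero
      change (HomologicalComplex.double (mapQM k K) rel_zero_one).d 0 1 ≫ _ = 0
      rw [HomologicalComplex.double_d _ _ zero_ne_one, Category.assoc, Category.assoc,
        Iso.inv_hom_id_assoc, h, comp_zero])

section derived

variable [HasDerivedCategory.{w₁} (GMod k K)] [HasDerivedCategory.{w₂} (DiscMod k K)]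

/-- The right derived functor of `γ_*` on the bounded below derived category, with values in the
derived category of discrete modules over the Galois group. -/
noncomputable def RgammaStar : DerivedCategory.Plus (GMod k K) ⥤ DerivedCategory (DiscMod k K) :=
  (gammaStar k K).rightDerivedFunctorPlus ⋙ DerivedCategory.Plus.ι

/-- `Rγ_* A` for the `G`-module `A` with trivial action. -/
noncomputable abbrev RgammaStarConst (A : Type) [AddCommGroup A] : DerivedCategory (DiscMod k K) :=
  (RgammaStar k K).obj ((DerivedCategory.Plus.singleFunctor (GMod k K) 0).obj (constG k K A))

/-- The canonical map `γ_* F → Rγ_* F` for a `G`-module `F`. -/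
noncomputable def toRgammaStar (F : GMod k K) :
    (DerivedCategory.singleFunctor (DiscMod k K) 0).obj ((gammaStar k K).obj F) ⟶
      (RgammaStar k K).obj ((DerivedCategory.Plus.singleFunctor (GMod k K) 0).obj F) :=
  DerivedCategory.Q.map
      ((HomologicalComplex.singleMapHomologicalComplex (gammaStar k K)
        (ComplexShape.up ℤ) 0).inv.app F) ≫
    DerivedCategory.Plus.ι.map ((gammaStar k K).rightDerivedFunctorPlusUnit.app
      ((HomotopyCategory.Plus.singleFunctor (GMod k K) 0).obj F))

/-- The canonical (adjunction) map `A → Rγ_* A` for an abelian group `A` with trivial action. -/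
noncomputable def unitConst (A : Type) [AddCommGroup A] :
    (DerivedCategory.singleFunctor (DiscMod k K) 0).obj (const k K A) ⟶ RgammaStarConst k K A :=
  (DerivedCategory.singleFunctor (DiscMod k K) 0).map (constUnit k K A) ≫
    toRgammaStar k K (constG k K A)

/-- The Bockstein morphism `β : ℚ/ℤ → ℤ[1]`: the connecting morphism of
`0 → ℤ → ℚ → ℚ/ℤ → 0`. -/
noncomputable def bockstein :
    (DerivedCategory.singleFunctor (DiscMod k K) 0).obj (const k K QZ) ⟶
      ((DerivedCategory.singleFunctor (DiscMod k K) 0).obj (const k K ℤ))⟦(1 : ℤ)⟧ :=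
  (bocksteinSeq_shortExact k K).singleδ

/-- The morphism `e : ℚ/ℤ → ℚ/ℤ[1]`: the connecting morphism of
`0 → ℚ/ℤ → N ⊗ ℚ/ℤ → ℚ/ℤ → 0`. -/
noncomputable def eQZ :
    (DerivedCategory.singleFunctor (DiscMod k K) 0).obj (const k K QZ) ⟶
      ((DerivedCategory.singleFunctor (DiscMod k K) 0).obj (const k K QZ))⟦(1 : ℤ)⟧ :=
  (extSeq_shortExact k K (AddMonoidHom.id QZ)).singleδ

/-- The composition `ℚ[-1] → ℚ/ℤ[-1] → ℚ/ℤ[0] → ℤ[1]` of the projection, `e[-1]` and `β`. -/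
noncomputable def boundary :
    ((DerivedCategory.singleFunctor (DiscMod k K) 0).obj (const k K ℚ))⟦(-1 : ℤ)⟧ ⟶
      ((DerivedCategory.singleFunctor (DiscMod k K) 0).obj (const k K ℤ))⟦(1 : ℤ)⟧ :=
  ((DerivedCategory.singleFunctor (DiscMod k K) 0).map (constMap k K projQZ))⟦(-1 : ℤ)⟧' ≫
    (eQZ k K)⟦(-1 : ℤ)⟧' ≫
    (shiftFunctorCompIsoId (DerivedCategory (DiscMod k K)) (1 : ℤ) (-1) (add_neg_cancel 1)).hom.app
      ((DerivedCategory.singleFunctor (DiscMod k K) 0).obj (const k K QZ)) ≫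
    bockstein k K

/-- The morphism `ℤ → ℤᶜ` in the derived category. -/
noncomputable def toZcD :
    (DerivedCategory.singleFunctor (DiscMod k K) 0).obj (const k K ℤ) ⟶
      DerivedCategory.Q.obj (Zc k K) :=
  DerivedCategory.Q.map (toZc k K)

/-- The morphism `ℤᶜ → ℚ[-1]` in the derived category. -/
noncomputable def fromZcD :
    DerivedCategory.Q.obj (Zc k K) ⟶
      ((DerivedCategory.singleFunctor (DiscMod k K) 0).obj (const k K ℚ))⟦(-1 : ℤ)⟧ :=
  DerivedCategory.Q.map (fromZc k K) ≫
    ((DerivedCategory.singleFunctors (DiscMod k K)).shiftIso (-1) 1 0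
      (neg_add_cancel 1)).inv.app (const k K ℚ)

end derived

end Galois
end WeilEtale

open CategoryTheory Limits Pretriangulated

/-! A group `A` with trivial action is resolved by the modules of functions on `G ≅ ℤ`: the complex
`(ℤ → A) ⟶ (ℤ → A)`, `f ↦ φ f - f`. The functor `γ_*` cuts such a module down to the periodic
functions. For `A = ℚ` the terms are coinduced from a divisible group, hence injective
(`injective_coind`), so `Rγ_* ℚ` is the difference operator on periodic rational functions. Its
kernel is the constants, and its cokernel is `ℚ` by the mean value, because the antiderivative of a
periodic function of mean zero is periodic. The mean value in both degrees identifies the complex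
with `ℚ ⊕ ℚ[-1]`.

For `A = ℤ` the terms need not be injective, but `0 → ℤ → ℚ → ℚ/ℤ → 0` resolves the complex by two
complexes of injectives, and `γ_*` keeps this resolution exact because a periodic function lifts
value by value. By `isIso_rightDerivedFunctorPlusUnit_app_of_shortExact` the periodic integral
functions therefore compute `Rγ_* ℤ`. The mean of an integral function is only rational, and this
produces the twist. In degree 0 the map to `ℤᶜ` is the mean; in degree 1 a map `r` to `ℚ/ℤ` is
needed with `r (φ f - f)` the class of the mean of `f`. It exists on the image of the difference
operator because integral constants have integral mean, and it extends because `ℚ/ℤ` is divisible.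
Then `r (φ ^ i f) = r f + i · mean f` in `ℚ/ℤ`, which is exactly equivariance of `(r, mean)` for the
action on `M`; the result is the quasi-isomorphism `quasiIso_gammaComplexToZc`.

The boundary map is read off the quotient of `ℤᶜ` by `ℤ`, the complex `ℚ/ℤ → M`, which is
quasi-isomorphic to `ℚ[-1]`. Projection to degree 0 maps `0 → ℤ → ℤᶜ → ℤᶜ/ℤ → 0` to the sequence
defining `β`, so the boundary is this projection followed by `β`. The projection itself is the
shifted connecting map of the extension `M` (`Q_map_toSingleZero`), and `M` is pulled back from the
extension defining `e`. -/

namespace CochainComplex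

/-! ### Short exact sequences of complexes and mapping cocones. -/

open CategoryTheory Limits HomologicalComplex

/-- A morphism to a complex which looks degreewise like the mapping cocone of the epimorphism of
a short exact sequence is a quasi-isomorphism. -/
lemma quasiIso_of_cocone_decomposition {E : Type*} [Category* E] [Abelian E]
    {S : ShortComplex (CochainComplex E ℤ)} (hS : S.ShortExact) {W : CochainComplex E ℤ}
    (φ : S.X₁ ⟶ W) (p : W ⟶ S.X₂) (s : ∀ n m : ℤ, m + 1 = n → (W.X n ⟶ S.X₃.X m))
    (i : ∀ n : ℤ, S.X₂.X n ⟶ W.X n) (hφp : φ ≫ p = S.f)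
    (hφs : ∀ n m (h : m + 1 = n), φ.f n ≫ s n m h = 0)
    (hip : ∀ n, i n ≫ p.f n = 𝟙 _) (his : ∀ n m (h : m + 1 = n), i n ≫ s n m h = 0)
    (hds : ∀ l m n (h : l + 1 = m) (h' : m + 1 = n),
      W.d m n ≫ s n m h' = -(p.f m ≫ S.g.f m) - s m l h ≫ S.X₃.d l m)
    (hext : ∀ n m (h : m + 1 = n) {A : E} (x y : A ⟶ W.X n), x ≫ p.f n = y ≫ p.f n →
      x ≫ s n m h = y ≫ s n m h → x = y) :
    QuasiIso φ where
  quasiIsoAt n := by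
    have hf (n : ℤ) : Mono (S.f.f n) := by have := hS.mono_f; infer_instance
    have hg (n : ℤ) : Epi (S.g.f n) := by have := hS.epi_g; infer_instance
    have hlift (n : ℤ) {A : E} (x : A ⟶ S.X₂.X n) (hx : x ≫ S.g.f n = 0) :
        ∃ y : A ⟶ S.X₁.X n, y ≫ S.f.f n = x :=
      have h : (S.map (eval E (ComplexShape.up ℤ) n)).Exact := hS.exact.map _
      have : Mono (S.map (eval E (ComplexShape.up ℤ) n)).f := hf n
      ⟨h.lift x hx, h.lift_f x hx⟩
    have hfg (n : ℤ) : S.f.f n ≫ S.g.f n = 0 := by rw [← comp_f, S.zero, zero_f]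
    have hφp' (n : ℤ) : φ.f n ≫ p.f n = S.f.f n := by rw [← comp_f, hφp]
    obtain ⟨m, rfl⟩ : ∃ m, n = m + 1 := ⟨n - 1, by simp⟩
    obtain ⟨l, rfl⟩ : ∃ l, m = l + 1 := ⟨m - 1, by simp⟩
    rw [quasiIsoAt_iff_isIso_homologyMap]
    have hprev : (ComplexShape.up ℤ).prev (l + 1 + 1) = l + 1 :=
      (ComplexShape.up ℤ).prev_eq' rfl
    have hnext : (ComplexShape.up ℤ).next (l + 1 + 1) = l + 1 + 1 + 1 :=
      (ComplexShape.up ℤ).next_eq' rfl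
    have : Mono (homologyMap φ (l + 1 + 1)) := by
      rw [mono_homologyMap_iff_up_to_refinements φ _ _ _ hprev hnext]
      intro A x hx y hy
      -- In terms of elements: let `φ x = d y`. If `c` lifts the component `s y` along `g`, then `p
      -- y + d c` is killed by `g`, hence comes from `X₁`, and its preimage has coboundary `x`.
      obtain ⟨A', π, hπ, c, hc⟩ := surjective_up_to_refinements_of_epi (S.g.f l) (y ≫ s (l + 1) l rfl)
      have h0 : y ≫ p.f (l + 1) ≫ S.g.f (l + 1) + (y ≫ s (l + 1) l rfl) ≫ S.X₃.d l (l + 1) = 0 := by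
        have := congr($hy ≫ s _ (l + 1) rfl)
        rw [Category.assoc, Category.assoc, hφs _ _ rfl, hds l _ _ rfl rfl, comp_zero,
          Preadditive.comp_sub, Preadditive.comp_neg] at this
        rw [Category.assoc, ← neg_eq_zero, this]
        abel
      obtain ⟨x₁, hx₁⟩ := hlift (l + 1) (π ≫ y ≫ p.f (l + 1) + c ≫ S.X₂.d l (l + 1)) (by
        rw [Preadditive.add_comp, Category.assoc, Category.assoc, Category.assoc, ← S.g.comm,
          ← reassoc_of% hc, ← Preadditive.comp_add, ← Category.assoc y (s _ _ _), h0, comp_zero])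
      refine ⟨A', π, hπ, x₁, ?_⟩
      rw [← cancel_mono (S.f.f _), Category.assoc, Category.assoc, ← S.f.comm, reassoc_of% hx₁,
        ← hφp', reassoc_of% hy]
      simp
    have : Epi (homologyMap φ (l + 1 + 1)) := by
      rw [epi_homologyMap_iff_up_to_refinements φ _ _ _ hprev hnext]
      intro A y hy
      obtain ⟨A', π, hπ, c, hc⟩ :=
        surjective_up_to_refinements_of_epi (S.g.f (l + 1)) (y ≫ s (l + 1 + 1) (l + 1) rfl)
      have h0 : y ≫ p.f (l + 1 + 1) ≫ S.g.f (l + 1 + 1) +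
          (y ≫ s (l + 1 + 1) (l + 1) rfl) ≫ S.X₃.d (l + 1) (l + 1 + 1) = 0 := by
        have := congr($hy ≫ s _ (l + 1 + 1) rfl)
        rw [Category.assoc, hds (l + 1) _ _ rfl rfl, zero_comp,
          Preadditive.comp_sub, Preadditive.comp_neg] at this
        rw [Category.assoc, ← neg_eq_zero, ← this]
        abel
      obtain ⟨x₁, hx₁⟩ := hlift (l + 1 + 1)
        (π ≫ y ≫ p.f (l + 1 + 1) + c ≫ S.X₂.d (l + 1) (l + 1 + 1)) (by
        rw [Preadditive.add_comp, Category.assoc, Category.assoc, Category.assoc, ← S.g.comm,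
          ← reassoc_of% hc, ← Preadditive.comp_add, ← Category.assoc y (s _ _ _), h0, comp_zero])
      -- Here `x₁` is the preimage of `p y + d c`. Comparison of the components under `p` and `s`
      -- gives `φ x₁ = y + d (i c)`, so `y` and `φ x₁` are cohomologous.
      refine ⟨A', π, hπ, x₁, ?_, -(c ≫ i _), ?_⟩
      · rw [← cancel_mono (S.f.f _), Category.assoc, ← S.f.comm, reassoc_of% hx₁,
          Preadditive.add_comp, zero_comp, Category.assoc, Category.assoc, Category.assoc,
          S.X₂.d_comp_d, comp_zero, add_zero, p.comm, reassoc_of% hy, zero_comp, comp_zero]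
      · refine hext _ (l + 1) rfl _ _ ?_ ?_
        · rw [Preadditive.add_comp, Category.assoc, Category.assoc, hφp', hx₁]
          simp only [Preadditive.neg_comp, Category.assoc, ← p.comm, reassoc_of% hip]
          abel
        · rw [Preadditive.add_comp, Category.assoc, Category.assoc, hφs _ _ rfl, hc]
          simp [hds l _ _ rfl rfl, reassoc_of% hip, reassoc_of% his (l + 1) l rfl]
    exact isIso_of_mono_of_epi _

open HomComplex

section

variable {C : Type*} [Category* C] [Abelian C] (S : ShortComplex (CochainComplex C ℤ))

/-- The morphism from the first term of a short complex of complexes to the mapping cocone of the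
second morphism. -/
noncomputable def liftShortComplex : S.X₁ ⟶ mappingCocone S.g :=
  mappingCocone.lift S.g S.f 0 (by simp)

/-- Sign conventions: the cocone is the cone shifted by `-1`. Both projections keep their sign, here
and in `mappingCocone_fst_f`, while the differential is negated in `mappingCocone_d`. The signs of
the projections enter the sign of the boundary map of the theorem. -/
lemma mappingCocone_snd_v {K L : CochainComplex C ℤ} (f : K ⟶ L) (m n : ℤ) (h : n + -1 = m) :
    (mappingCocone.snd f).v n m h = (mappingCone.snd f).v (n + -1) m (by lia) := by
  have h1 := Cochain.leftShift_v (mappingCone.snd f) (-1) (-1) (zero_add _) n m h (n + -1) (by lia)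
  refine h1.trans ?_
  rw [show (-1 * -1 + -1 * (-1 - 1) / 2 : ℤ).negOnePow = 1 from Int.negOnePow_even _ ⟨1, by norm_num⟩,
    one_smul]
  exact Category.id_comp _

lemma mappingCocone_fst_f {K L : CochainComplex C ℤ} (f : K ⟶ L) (n : ℤ) :
    (mappingCocone.fst f).f n = (mappingCone.fst f).1.v (n + -1) n (by lia) := by
  have h1 := Cochain.leftShift_v (mappingCone.fst f).1 (-1) 0 (add_neg_cancel 1) n n (by lia)
    (n + -1) (by lia)
  -- The first projection is the negative of a left shift, whose own sign is `-1`, so the two signs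
  -- cancel.
  refine (congrArg Neg.neg h1).trans ?_
  rw [show (-1 * 0 + -1 * (-1 - 1) / 2 : ℤ).negOnePow = -1 from Int.negOnePow_odd _ ⟨0, by norm_num⟩,
    Units.neg_smul, one_smul, neg_neg]
  exact Category.id_comp _

lemma mappingCocone_d {K L : CochainComplex C ℤ} (f : K ⟶ L) (m n : ℤ) :
    (mappingCocone f).d m n = -(mappingCone f).d (m + -1) (n + -1) := by
  refine (congrArg (· • (mappingCone f).d (m + -1) (n + -1))
    (Int.negOnePow_odd (-1) ⟨-1, rfl⟩)).trans ?_
  rw [Units.neg_smul, one_smul]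

lemma mappingCocone_d_snd_v {K L : CochainComplex C ℤ} (f : K ⟶ L) (l m n : ℤ) (hlm : l + 1 = m)
    (hmn : m + 1 = n) :
    (mappingCocone f).d m n ≫ (mappingCocone.snd f).v n m (by lia) =
      -((mappingCocone.fst f).f m ≫ f.f m) - (mappingCocone.snd f).v m l (by lia) ≫ L.d l m := by
  -- The degrees `m + -1` and `n + -1` are generalised to variables so that they can be identified
  -- with `l` and `m` by substitution.
  have aux (i j : ℤ) (hi : i + 1 = m) (hj : j + 0 = m) (hl : i + 0 = l) :
      (mappingCone f).d i j ≫ (mappingCone.snd f).v j m hj =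
        (mappingCone.fst f).1.v i m (by lia) ≫ f.f m +
          (mappingCone.snd f).v i l hl ≫ L.d l m := by
    obtain rfl : j = m := by lia
    obtain rfl : i = l := by lia
    exact mappingCone.d_snd_v f _ _ (by lia)
  rw [mappingCocone_snd_v, mappingCocone_snd_v, mappingCocone_fst_f, mappingCocone_d]
  refine (Preadditive.neg_comp _ _).trans ?_
  refine (congrArg Neg.neg (aux _ _ (by lia) (by lia) (by lia))).trans ?_
  exact (neg_add _ _).trans (sub_eq_add_neg _ _).symm

/-- The splitting of the cocone in each degree and the formula for its differential are additive
identities, so every additive functor preserves them. The criterion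
`quasiIso_of_cocone_decomposition` asks only for these, hence no exactness of `F` beyond `hS` is
needed. It is applied both to the identity and to the functor being derived. -/
lemma quasiIso_map_liftShortComplex {E : Type*} [Category* E] [Abelian E] (F : C ⥤ E)
    [F.Additive] (hS : (S.map (F.mapHomologicalComplex (ComplexShape.up ℤ))).ShortExact) :
    QuasiIso ((F.mapHomologicalComplex (ComplexShape.up ℤ)).map (liftShortComplex S)) := by
  refine quasiIso_of_cocone_decomposition hS _
    ((F.mapHomologicalComplex (ComplexShape.up ℤ)).map (mappingCocone.fst S.g))
    (fun n m h ↦ F.map ((mappingCocone.snd S.g).v n m (by lia)))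
    (fun n ↦ F.map ((mappingCocone.inl S.g).v n n (add_zero n))) ?_ ?_ ?_ ?_ ?_ ?_
  · exact (Functor.map_comp _ _ _).symm.trans (congrArg _ (mappingCocone.lift_fst _ _ _ _))
  · intro n m hnm
    exact (F.map_comp _ _).symm.trans
      ((congrArg F.map (mappingCocone.lift_f_snd_v _ _ _ _ _ _ _)).trans (F.map_zero _ _))
  · intro n
    exact (F.map_comp _ _).symm.trans
      ((congrArg F.map (mappingCocone.inl_v_fst_f _ _)).trans (F.map_id _))
  · intro n m hnm
    exact (F.map_comp _ _).symm.trans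
      ((congrArg F.map (mappingCocone.inl_v_snd_v _ _ _ _)).trans (F.map_zero _ _))
  · intro l m n hlm hmn
    have h := congrArg F.map (mappingCocone_d_snd_v S.g l m n hlm hmn)
    rw [F.map_sub, F.map_neg, F.map_comp, F.map_comp, F.map_comp] at h
    exact h
  · intro n m hnm A x y hp hs
    have h := congrArg F.map (mappingCocone.id_X S.g n m (by lia))
    rw [F.map_id, F.map_add, F.map_comp, F.map_comp] at h
    have key (z : A ⟶ F.obj ((mappingCocone S.g).X n)) :
        z = (z ≫ F.map ((mappingCocone.fst S.g).f n)) ≫ F.map ((mappingCocone.inl S.g).v n n (add_zero n)) +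
          (z ≫ F.map ((mappingCocone.snd S.g).v n m (by lia))) ≫
            F.map ((mappingCocone.inr S.g).1.v m n hnm) := by
      rw [Category.assoc, Category.assoc, ← Preadditive.comp_add, h, Category.comp_id]
    refine (key x).trans (Eq.trans ?_ (key y).symm)
    exact congrArg₂ (fun a b ↦ a ≫ F.map ((mappingCocone.inl S.g).v n n (add_zero n)) +
      b ≫ F.map ((mappingCocone.inr S.g).1.v m n hnm)) hp hs

end

end CochainComplex

/-! ### Complexes at which the unit of the right derived functor is invertible. -/

namespace CategoryTheory.Functor

open Limits HomologicalComplex CochainComplex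

variable {C D : Type*} [Category* C] [Category* D] [Abelian C] [Abelian D]
  [HasDerivedCategory C] [HasDerivedCategory D]
  (F : C ⥤ D) [F.Additive] [EnoughInjectives C]

/-- The unit `F X₁ ⟶ RF X₁` is an isomorphism for a complex `X₁` which admits a resolution
`0 ⟶ X₁ ⟶ X₂ ⟶ X₃ ⟶ 0` by bounded below complexes of injectives that remains exact under `F`. -/
lemma isIso_rightDerivedFunctorPlusUnit_app_of_shortExact
    (S : ShortComplex (CochainComplex C ℤ)) (hS : S.ShortExact)
    (hFS : (S.map (F.mapHomologicalComplex (ComplexShape.up ℤ))).ShortExact)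
    (h₁ : CochainComplex.plus C S.X₁) (n : ℤ) [S.X₂.IsStrictlyGE n] [S.X₃.IsStrictlyGE n]
    [∀ i, Injective (S.X₂.X i)] [∀ i, Injective (S.X₃.X i)] :
    IsIso (F.rightDerivedFunctorPlusUnit.app ((HomotopyCategory.Plus.quotient C).obj
      ⟨S.X₁, h₁⟩)) := by
  have h : CochainComplex.plus C (mappingCocone S.g) := by
    -- The cone starts in degree `n - 1`, one below its two terms; the shift by `-1` brings it back
    -- to `n`.
    have := isStrictlyGE_mappingCone S.g n n (n - 1)
    exact ⟨n, (mappingCone S.g).isStrictlyGE_shift (n - 1) (-1) n (by lia)⟩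
  have (i : ℤ) : Injective ((mappingCocone S.g).X i) :=
    Injective.of_iso (homotopyCofiber.XIsoBiprod S.g (i + -1) i (by simp)).symm inferInstance
  let f : (⟨S.X₁, h₁⟩ : CochainComplex.Plus C) ⟶ ⟨mappingCocone S.g, h⟩ :=
    ObjectProperty.homMk (liftShortComplex S)
  have hf : HomotopyCategory.Plus.quasiIso C ((HomotopyCategory.Plus.quotient C).map f) := by
    refine (HomotopyCategory.quotient_map_mem_quasiIso_iff _).2 ?_
    exact quasiIso_map_liftShortComplex S (𝟭 C) hS
  have hFf : HomotopyCategory.Plus.quasiIso D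
      (F.mapHomotopyCategoryPlus.map ((HomotopyCategory.Plus.quotient C).map f)) := by
    refine (HomotopyCategory.quotient_map_mem_quasiIso_iff
      ((F.mapHomologicalComplex (ComplexShape.up ℤ)).map (liftShortComplex S))).2 ?_
    exact quasiIso_map_liftShortComplex S F hFS
  have h₂ := Localization.inverts DerivedCategory.Plus.Qh _ _ hf
  have h₃ := Localization.inverts DerivedCategory.Plus.Qh _ _ hFf
  -- The cocone is a bounded below complex of injectives, where the unit is invertible. Naturality
  -- along `f` carries this to `X₁`, because `f` and its image under `F` are both
  -- quasi-isomorphisms.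
  have h₄ : IsIso (F.rightDerivedFunctorPlusUnit.app ((HomotopyCategory.Plus.quotient C).obj
      ⟨mappingCocone S.g, h⟩)) := by infer_instance
  have nat := F.rightDerivedFunctorPlusUnit.naturality ((HomotopyCategory.Plus.quotient C).map f)
  have h₅ : IsIso ((F.mapHomotopyCategoryPlus ⋙ DerivedCategory.Plus.Qh).map
      ((HomotopyCategory.Plus.quotient C).map f)) := h₃
  have h₆ : IsIso ((DerivedCategory.Plus.Qh ⋙ F.rightDerivedFunctorPlus).map
      ((HomotopyCategory.Plus.quotient C).map f)) := by
    rw [Functor.comp_map]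
    infer_instance
  have := IsIso.comp_isIso' h₅ h₄
  rw [nat] at this
  exact IsIso.of_isIso_comp_right _ ((DerivedCategory.Plus.Qh ⋙ F.rightDerivedFunctorPlus).map
      ((HomotopyCategory.Plus.quotient C).map f))

end CategoryTheory.Functor

/-! ### Two-term complexes and quasi-isomorphisms checked on elements. -/

namespace CategoryTheory.ShortComplex

/-- A morphism of short complexes of abelian groups is a quasi-isomorphism if it is bijective on
homology, in terms of elements. -/
lemma quasiIso_of_ab {S₁ S₂ : ShortComplex AddCommGrpCat.{u}} (φ : S₁ ⟶ S₂)
    (hinj : ∀ (x : S₁.X₂) (y : S₂.X₁), S₁.g x = 0 → φ.τ₂ x = S₂.f y → ∃ w, S₁.f w = x)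
    (hsurj : ∀ z : S₂.X₂, S₂.g z = 0 → ∃ x y, S₁.g x = 0 ∧ φ.τ₂ x = z + S₂.f y) :
    QuasiIso φ := by
  let φK : S₁.g.hom.ker →+ S₂.g.hom.ker := (φ.τ₂.hom.comp S₁.g.hom.ker.subtype).codRestrict _ (by
    rintro ⟨x, hx⟩
    have h := ConcreteCategory.congr_hom φ.comm₂₃ x
    have hx : S₁.g x = 0 := hx
    change S₂.g (φ.τ₂ x) = 0
    refine Eq.trans h ?_
    change φ.τ₃ (S₁.g x) = 0
    rw [hx, map_zero])
  have hφK (x : S₁.X₁) : φK (S₁.abToCycles x) = S₂.abToCycles (φ.τ₁ x) :=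
    Subtype.ext (ConcreteCategory.congr_hom φ.comm₁₂ x).symm
  let φH : (S₁.g.hom.ker ⧸ S₁.abToCycles.range) →+ (S₂.g.hom.ker ⧸ S₂.abToCycles.range) :=
    QuotientAddGroup.map _ _ φK (by
      rintro _ ⟨x, rfl⟩
      exact ⟨φ.τ₁ x, (hφK x).symm⟩)
  let γ : LeftHomologyMapData φ S₁.abLeftHomologyData S₂.abLeftHomologyData :=
    { φK := AddCommGrpCat.ofHom φK
      φH := AddCommGrpCat.ofHom φH
      commi := rfl
      commf' := by
        ext x
        exact hφK x
      commπ := rfl }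
  rw [LeftHomologyMapData.quasiIso_iff γ]
  refine (ConcreteCategory.isIso_iff_bijective (AddCommGrpCat.ofHom φH)).2 ⟨?_, ?_⟩
  · refine (injective_iff_map_eq_zero φH).2 fun a ha ↦ ?_
    induction a using QuotientAddGroup.induction_on with
    | H a =>
      obtain ⟨y, hy⟩ := (QuotientAddGroup.eq_zero_iff _).1 ha
      obtain ⟨w, hw⟩ := hinj a.1 y a.2 (congrArg Subtype.val hy).symm
      exact (QuotientAddGroup.eq_zero_iff _).2 ⟨w, Subtype.ext hw⟩
  · intro b
    induction b using QuotientAddGroup.induction_on with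
    | H b =>
      obtain ⟨x, y, hx, hxy⟩ := hsurj b.1 b.2
      refine ⟨QuotientAddGroup.mk ⟨x, hx⟩, (QuotientAddGroup.eq.2 ⟨-y, Subtype.ext ?_⟩)⟩
      change S₂.f (-y) = -φ.τ₂ x + b.1
      rw [hxy, map_neg]
      abel

end CategoryTheory.ShortComplex

namespace CochainComplex

open CategoryTheory Limits HomologicalComplex

/-- The data of an identification of a cochain complex with a complex `A₀ ⟶ A₁` in degrees
`0` and `1`. -/
structure TwoTerm {C : Type*} [Category* C] [HasZeroMorphisms C] (K : CochainComplex C ℤ)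
    {A₀ A₁ : C} (f : A₀ ⟶ A₁) where
  /-- the term in degree `0` -/
  iso₀ : K.X 0 ≅ A₀
  /-- the term in degree `1` -/
  iso₁ : K.X 1 ≅ A₁
  comm : K.d 0 1 ≫ iso₁.hom = iso₀.hom ≫ f
  isZero : ∀ i, i ≠ 0 → i ≠ 1 → IsZero (K.X i)

namespace TwoTerm

section

variable {C D : Type*} [Category* C] [Category* D] [HasZeroMorphisms C] [HasZeroMorphisms D]

/-- The complex `double f` is a two-term complex. -/
noncomputable def double [HasZeroObject C] {A₀ A₁ : C} (f : A₀ ⟶ A₁)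
    (h : (ComplexShape.up ℤ).Rel 0 1) : TwoTerm (HomologicalComplex.double f h) f where
  iso₀ := doubleXIso₀ f h
  iso₁ := doubleXIso₁ f h zero_ne_one
  comm := by rw [double_d f h zero_ne_one]; simp
  isZero := isZero_double_X f h

/-- A single complex as a two-term complex. -/
noncomputable def single [HasZeroObject C] (A : C) {Z : C} (hZ : IsZero Z) :
    TwoTerm ((HomologicalComplex.single C (ComplexShape.up ℤ) 0).obj A) (0 : A ⟶ Z) where
  iso₀ := singleObjXSelf _ _ _
  iso₁ := (isZero_single_obj_X _ _ _ _ one_ne_zero).iso hZ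
  comm := by simp
  isZero _ h _ := isZero_single_obj_X _ _ _ _ h

variable {K : CochainComplex C ℤ} {A₀ A₁ : C} {f : A₀ ⟶ A₁}

/-- The image of a two-term complex by a functor. -/
def map (hK : TwoTerm K f) (F : C ⥤ D) [F.PreservesZeroMorphisms] :
    TwoTerm ((F.mapHomologicalComplex (ComplexShape.up ℤ)).obj K) (F.map f) where
  iso₀ := F.mapIso hK.iso₀
  iso₁ := F.mapIso hK.iso₁
  comm := ((F.map_comp _ _).symm.trans (congrArg F.map hK.comm)).trans (F.map_comp _ _)
  isZero i h₀ h₁ := F.map_isZero (hK.isZero i h₀ h₁)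

lemma isStrictlyGE (hK : TwoTerm K f) : K.IsStrictlyGE 0 := by
  rw [isStrictlyGE_iff]
  exact fun i hi ↦ hK.isZero i hi.ne (by lia)

lemma hom_ext (hK : TwoTerm K f) {L : CochainComplex C ℤ} {φ ψ : K ⟶ L} (h₀ : φ.f 0 = ψ.f 0)
    (h₁ : φ.f 1 = ψ.f 1) : φ = ψ := by
  ext i
  by_cases hi₀ : i = 0
  · rw [hi₀, h₀]
  by_cases hi₁ : i = 1
  · rw [hi₁, h₁]
  exact (hK.isZero i hi₀ hi₁).eq_of_src _ _

section

variable {L : CochainComplex C ℤ} {B₀ B₁ : C} {g : B₀ ⟶ B₁} (hK : TwoTerm K f) (hL : TwoTerm L g)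
  (a₀ : A₀ ⟶ B₀) (a₁ : A₁ ⟶ B₁) (comm : f ≫ a₁ = a₀ ≫ g)

/-- The morphism of two-term complexes induced by a commutative square. -/
noncomputable def hom : K ⟶ L where
  f i := if h₀ : i = 0 then
      (K.XIsoOfEq h₀).hom ≫ (hK.iso₀.hom ≫ a₀ ≫ hL.iso₀.inv) ≫ (L.XIsoOfEq h₀).inv
    else if h₁ : i = 1 then
      (K.XIsoOfEq h₁).hom ≫ (hK.iso₁.hom ≫ a₁ ≫ hL.iso₁.inv) ≫ (L.XIsoOfEq h₁).inv
    else 0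
  comm' i j hij := by
    obtain rfl : i + 1 = j := hij
    by_cases hi₀ : i = 0
    · subst hi₀
      have hL' : hL.iso₀.inv ≫ L.d 0 1 = g ≫ hL.iso₁.inv := by
        rw [Iso.inv_comp_eq, ← Category.assoc, ← hL.comm, Category.assoc, Iso.hom_inv_id,
          Category.comp_id]
      have key : (hK.iso₀.hom ≫ a₀ ≫ hL.iso₀.inv) ≫ L.d 0 1 =
          K.d 0 1 ≫ hK.iso₁.hom ≫ a₁ ≫ hL.iso₁.inv := by
        rw [reassoc_of% hK.comm, reassoc_of% comm, Category.assoc, Category.assoc, hL']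
      simpa using key
    by_cases hi₁ : i = 1
    · exact (hL.isZero (i + 1) (by lia) (by lia)).eq_of_tgt _ _
    · exact (hK.isZero i hi₀ hi₁).eq_of_src _ _

lemma hom_f_zero : (hom hK hL a₀ a₁ comm).f 0 = hK.iso₀.hom ≫ a₀ ≫ hL.iso₀.inv := by
  simp [hom]

lemma hom_f_one : (hom hK hL a₀ a₁ comm).f 1 = hK.iso₁.hom ≫ a₁ ≫ hL.iso₁.inv := by
  simp [hom]

lemma hom_f_zero_iso₀ :
    (hom hK hL a₀ a₁ comm).f 0 ≫ hL.iso₀.hom = hK.iso₀.hom ≫ a₀ := by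
  simp [hom_f_zero]

lemma hom_f_one_iso₁ :
    (hom hK hL a₀ a₁ comm).f 1 ≫ hL.iso₁.hom = hK.iso₁.hom ≫ a₁ := by
  simp [hom_f_one]

end

end

/-- Homology is the kernel in degree 0 and the cokernel in degree 1. The four conditions on elements
are injectivity and surjectivity on these two groups; in all other degrees both complexes vanish. -/
lemma quasiIso_ab {K L : CochainComplex AddCommGrpCat.{u} ℤ} {A₀ A₁ B₀ B₁ : AddCommGrpCat.{u}}
    {f : A₀ ⟶ A₁} {g : B₀ ⟶ B₁} (hK : TwoTerm K f) (hL : TwoTerm L g) (φ : K ⟶ L)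
    (a₀ : A₀ ⟶ B₀) (a₁ : A₁ ⟶ B₁) (h₀ : φ.f 0 ≫ hL.iso₀.hom = hK.iso₀.hom ≫ a₀)
    (h₁ : φ.f 1 ≫ hL.iso₁.hom = hK.iso₁.hom ≫ a₁)
    (hinj₀ : ∀ x : A₀, f x = 0 → a₀ x = 0 → x = 0)
    (hsurj₀ : ∀ z : B₀, g z = 0 → ∃ x, f x = 0 ∧ a₀ x = z)
    (hinj₁ : ∀ (x : A₁) (y : B₀), a₁ x = g y → ∃ w, f w = x)
    (hsurj₁ : ∀ z : B₁, ∃ x y, a₁ x = z + g y) :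
    QuasiIso φ where
  quasiIsoAt i := by
    have i₀K : Function.Bijective hK.iso₀.hom :=
      (ConcreteCategory.isIso_iff_bijective hK.iso₀.hom).1 inferInstance
    have i₁K : Function.Bijective hK.iso₁.hom :=
      (ConcreteCategory.isIso_iff_bijective hK.iso₁.hom).1 inferInstance
    have i₀L : Function.Bijective hL.iso₀.hom :=
      (ConcreteCategory.isIso_iff_bijective hL.iso₀.hom).1 inferInstance
    have i₁L : Function.Bijective hL.iso₁.hom :=
      (ConcreteCategory.isIso_iff_bijective hL.iso₁.hom).1 inferInstance
    have h₀ (x) : hL.iso₀.hom (φ.f 0 x) = a₀ (hK.iso₀.hom x) := ConcreteCategory.congr_hom h₀ x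
    have h₁ (x) : hL.iso₁.hom (φ.f 1 x) = a₁ (hK.iso₁.hom x) := ConcreteCategory.congr_hom h₁ x
    have hK' (x) : hK.iso₁.hom (K.d 0 1 x) = f (hK.iso₀.hom x) :=
      ConcreteCategory.congr_hom hK.comm x
    have hL' (x) : hL.iso₁.hom (L.d 0 1 x) = g (hL.iso₀.hom x) :=
      ConcreteCategory.congr_hom hL.comm x
    by_cases hi₀ : i = 0
    · subst hi₀
      rw [quasiIsoAt_iff' φ (-1) 0 1 ((ComplexShape.up ℤ).prev_eq' (by simp))
        ((ComplexShape.up ℤ).next_eq' (by simp))]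
      have hL₀ (y : L.X (-1)) : y = 0 := by
        have := AddCommGrpCat.subsingleton_of_isZero (hL.isZero (-1) (by simp) (by simp))
        exact Subsingleton.elim _ _
      refine ShortComplex.quasiIso_of_ab _ ?_ ?_
      · intro (x : K.X 0) (y : L.X (-1)) hx hxy
        have hx : K.d 0 1 x = 0 := hx
        have hxy : φ.f 0 x = L.d (-1) 0 y := hxy
        rw [hL₀ y, map_zero] at hxy
        refine ⟨0, (map_zero _).trans ?_⟩
        refine (i₀K.1 ((hinj₀ _ ?_ ?_).trans (map_zero _).symm)).symm
        · rw [← hK', hx, map_zero]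
        · rw [← h₀, hxy, map_zero]
      · intro (z : L.X 0) hz
        have hz : L.d 0 1 z = 0 := hz
        obtain ⟨x, hx, hxz⟩ := hsurj₀ (hL.iso₀.hom z) (by rw [← hL', hz, map_zero])
        obtain ⟨x, rfl⟩ := i₀K.2 x
        refine ⟨x, 0, i₁K.1 ?_, i₀L.1 ?_⟩
        · exact (hK' x).trans (hx.trans (map_zero _).symm)
        · refine (h₀ x).trans (hxz.trans ?_)
          rw [map_zero]
          exact congrArg hL.iso₀.hom (add_zero z).symm
    by_cases hi₁ : i = 1
    · subst hi₁
      rw [quasiIsoAt_iff' φ 0 1 2 ((ComplexShape.up ℤ).prev_eq' (by simp))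
        ((ComplexShape.up ℤ).next_eq' (by simp))]
      refine ShortComplex.quasiIso_of_ab _ ?_ ?_
      · intro (x : K.X 1) (y : L.X 0) hx hxy
        have hxy : φ.f 1 x = L.d 0 1 y := hxy
        obtain ⟨w, hw⟩ := hinj₁ (hK.iso₁.hom x) (hL.iso₀.hom y) (by rw [← h₁, hxy, hL'])
        obtain ⟨w, rfl⟩ := i₀K.2 w
        exact ⟨w, i₁K.1 ((hK' w).trans hw)⟩
      · intro (z : L.X 1) hz
        obtain ⟨x, y, hxy⟩ := hsurj₁ (hL.iso₁.hom z)
        obtain ⟨x, rfl⟩ := i₁K.2 x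
        obtain ⟨y, rfl⟩ := i₀L.2 y
        refine ⟨x, y, ?_, i₁L.1 ?_⟩
        · have := AddCommGrpCat.subsingleton_of_isZero (hK.isZero 2 (by simp) (by simp))
          exact Subsingleton.elim (α := K.X 2) _ _
        · refine (h₁ x).trans (hxy.trans ?_)
          rw [← hL']
          exact (map_add _ _ _).symm
    · rw [quasiIsoAt_iff_exactAt _ _ (ExactAt.of_isZero (hK.isZero i hi₀ hi₁))]
      exact ExactAt.of_isZero (hL.isZero i hi₀ hi₁)

variable {C : Type*} [Category* C] [Abelian C]

/-- A morphism of two-term complexes is a quasi-isomorphism if it is so on elements, for an exact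
conservative functor to abelian groups. -/
lemma quasiIso (F : C ⥤ AddCommGrpCat.{u}) [F.Additive] [F.PreservesHomology]
    [F.ReflectsIsomorphisms] {K L : CochainComplex C ℤ} {A₀ A₁ B₀ B₁ : C}
    {f : A₀ ⟶ A₁} {g : B₀ ⟶ B₁} (hK : TwoTerm K f) (hL : TwoTerm L g) (φ : K ⟶ L)
    (a₀ : A₀ ⟶ B₀) (a₁ : A₁ ⟶ B₁) (h₀ : φ.f 0 ≫ hL.iso₀.hom = hK.iso₀.hom ≫ a₀)
    (h₁ : φ.f 1 ≫ hL.iso₁.hom = hK.iso₁.hom ≫ a₁)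
    (hinj₀ : ∀ x : F.obj A₀, F.map f x = 0 → F.map a₀ x = 0 → x = 0)
    (hsurj₀ : ∀ z : F.obj B₀, F.map g z = 0 → ∃ x, F.map f x = 0 ∧ F.map a₀ x = z)
    (hinj₁ : ∀ (x : F.obj A₁) (y : F.obj B₀), F.map a₁ x = F.map g y → ∃ w, F.map f w = x)
    (hsurj₁ : ∀ z : F.obj B₁, ∃ x y, F.map a₁ x = z + F.map g y) :
    QuasiIso φ := by
  rw [← quasiIso_map_iff_of_preservesHomology φ F]
  refine quasiIso_ab (hK.map F) (hL.map F) _ (F.map a₀) (F.map a₁) ?_ ?_ hinj₀ hsurj₀ hinj₁ hsurj₁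
  · exact ((F.map_comp _ _).symm.trans (congrArg F.map h₀)).trans (F.map_comp _ _)
  · exact ((F.map_comp _ _).symm.trans (congrArg F.map h₁)).trans (F.map_comp _ _)

/-- A sequence of two-term complexes is short exact if it is so in degrees `0` and `1`. -/
lemma shortExact {S : ShortComplex (CochainComplex C ℤ)} {T₀ T₁ : ShortComplex C}
    (f : T₀ ⟶ T₁) (h₁ : TwoTerm S.X₁ f.τ₁) (h₂ : TwoTerm S.X₂ f.τ₂) (h₃ : TwoTerm S.X₃ f.τ₃)
    (hf₀ : S.f.f 0 ≫ h₂.iso₀.hom = h₁.iso₀.hom ≫ T₀.f)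
    (hf₁ : S.f.f 1 ≫ h₂.iso₁.hom = h₁.iso₁.hom ≫ T₁.f)
    (hg₀ : S.g.f 0 ≫ h₃.iso₀.hom = h₂.iso₀.hom ≫ T₀.g)
    (hg₁ : S.g.f 1 ≫ h₃.iso₁.hom = h₂.iso₁.hom ≫ T₁.g)
    (hT₀ : T₀.ShortExact) (hT₁ : T₁.ShortExact) : S.ShortExact := by
  refine shortExact_of_degreewise_shortExact S fun i ↦ ?_
  by_cases hi₀ : i = 0
  · subst hi₀
    exact (ShortComplex.shortExact_iff_of_iso
      (ShortComplex.isoMk (S₁ := S.map (eval C (ComplexShape.up ℤ) 0))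
        h₁.iso₀ h₂.iso₀ h₃.iso₀ hf₀.symm hg₀.symm)).2 hT₀
  by_cases hi₁ : i = 1
  · subst hi₁
    exact (ShortComplex.shortExact_iff_of_iso
      (ShortComplex.isoMk (S₁ := S.map (eval C (ComplexShape.up ℤ) 1))
        h₁.iso₁ h₂.iso₁ h₃.iso₁ hf₁.symm hg₁.symm)).2 hT₁
  exact
    { exact := ShortComplex.exact_of_isZero_X₂ _ (h₂.isZero i hi₀ hi₁)
      mono_f := ⟨fun _ _ _ ↦ (h₁.isZero i hi₀ hi₁).eq_of_tgt _ _⟩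
      epi_g := ⟨fun _ _ _ ↦ (h₃.isZero i hi₀ hi₁).eq_of_src _ _⟩ }

end TwoTerm

end CochainComplex

/-! ### The coinduced resolution of a trivial `G`-module. -/

namespace WeilEtale

open CategoryTheory Limits

section

variable (k : Type v) (K : Type u) [Field k] [Fintype k] [Field K] [Algebra k K]
  [IsAlgClosed K] [Algebra.IsAlgebraic k K]

/-- The Frobenius has infinite order because its exponent is determined modulo every positive `m` by
the action on the fixed field of `φ ^ m`. -/
lemma frobW_pow_injective : Function.Injective fun n : ℕ ↦ frobW k K ^ n := by
  intro i j hij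
  have h : frob k K ^ i = frob k K ^ j := congrArg Subtype.val hij
  -- The modulus `i + j + 1` exceeds both exponents, so congruent exponents are equal.
  have hi := frobCongr_pow (k := k) (K := K) (i + j + 1) i
  have hj := frobCongr_pow (k := k) (K := K) (i + j + 1) j
  rw [← h] at hj
  exact (hi.modEq (Nat.succ_pos _) hj).eq_of_lt_of_lt (by lia) (by lia)

/-- The isomorphism of `ℤ` with the group generated by the Frobenius. -/
noncomputable def frobEquiv : Multiplicative ℤ ≃* WeilGroup k K :=
  MulEquiv.ofBijective (zpowersHom _ (frobW k K)) (by
    constructor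
    · exact injective_zpow_iff_not_isOfFinOrder.2
        (injective_pow_iff_not_isOfFinOrder.1 (frobW_pow_injective k K))
    · rintro ⟨_, n, rfl⟩
      exact ⟨Multiplicative.ofAdd n, Subtype.ext (by simp [frobW])⟩)

variable {k K} in
/-- The exponent `n` of an element `φ ^ n`. -/
noncomputable def frobLog (g : WeilGroup k K) : ℤ := ((frobEquiv k K).symm g).toAdd

@[simp]
lemma frobLog_one : frobLog (1 : WeilGroup k K) = 0 := by simp [frobLog]

variable {k K} in
lemma frobLog_mul (g h : WeilGroup k K) : frobLog (g * h) = frobLog g + frobLog h := by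
  simp [frobLog]

@[simp]
lemma frobLog_zpow (n : ℤ) : frobLog (frobW k K ^ n) = n := by
  have : frobW k K ^ n = frobEquiv k K (Multiplicative.ofAdd n) := rfl
  rw [this, frobLog, MulEquiv.symm_apply_apply]
  rfl

@[simp]
lemma frobLog_pow (n : ℕ) : frobLog (frobW k K ^ n) = n := by
  rw [← zpow_natCast, frobLog_zpow]

variable {k K} in
lemma zpow_frobLog (g : WeilGroup k K) : frobW k K ^ frobLog g = g := by
  obtain ⟨n, rfl⟩ := (frobEquiv k K).surjective g
  have : frobEquiv k K n = frobW k K ^ n.toAdd := rfl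
  rw [this, frobLog_zpow]

/-- The `G`-module of all functions `ℤ → A`, on which the Frobenius acts by translation. -/
noncomputable def coind (A : Type) [AddCommGroup A] : GMod k K :=
  mkMod (ℤ → A)
    { toFun g := AddMonoidHom.mk' (fun f n ↦ f (n + frobLog g)) fun _ _ ↦ rfl
      map_one' := by
        refine AddMonoidHom.ext fun f ↦ funext fun n ↦ ?_
        change f (n + frobLog 1) = f n
        rw [frobLog_one, add_zero]
      map_mul' g h := by
        refine AddMonoidHom.ext fun f ↦ funext fun n ↦ ?_
        change f (n + frobLog (g * h)) = f (n + frobLog g + frobLog h)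
        rw [frobLog_mul, add_assoc] }

variable (A B : Type) [AddCommGroup A] [AddCommGroup B]

lemma act_coind (g : WeilGroup k K) (f : ℤ → A) (n : ℤ) :
    (act (coind k K A) g f : ℤ → A) n = f (n + frobLog g) := rfl

/-- The difference operator `f ↦ φ f - f`. -/
noncomputable def coindDiff : coind k K A ⟶ coind k K A :=
  mkHom (AddMonoidHom.mk' (fun (f : ℤ → A) n ↦ f (n + 1) - f n) fun f g ↦ by
    funext n
    exact add_sub_add_comm _ _ _ _) fun g f ↦ by
      funext n
      change f (n + 1 + frobLog g) - f (n + frobLog g) = f (n + frobLog g + 1) - f (n + frobLog g)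
      rw [add_right_comm]

variable {A B} in
/-- The homomorphism of modules of functions induced by a homomorphism of groups. -/
noncomputable def coindMap (p : A →+ B) : coind k K A ⟶ coind k K B :=
  mkHom (AddMonoidHom.mk' (fun (f : ℤ → A) n ↦ p (f n)) fun _ _ ↦ funext fun _ ↦ map_add p _ _)
    fun _ _ ↦ rfl

variable {A B} in
lemma coindDiff_coindMap (p : A →+ B) :
    coindDiff k K A ≫ coindMap k K p = coindMap k K p ≫ coindDiff k K B :=
  Action.hom_ext _ _ <| AddCommGrpCat.hom_ext <| AddMonoidHom.ext fun _ ↦ funext fun _ ↦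
    map_sub p _ _

/-- The inclusion of the constant functions. -/
noncomputable def constToCoind : constG k K A ⟶ coind k K A :=
  mkHom (V := constG k K A) (AddMonoidHom.mk' (fun (a : A) (_ : ℤ) ↦ a) fun _ _ ↦ rfl)
    fun _ _ ↦ rfl

lemma constToCoind_coindDiff : constToCoind k K A ≫ coindDiff k K A = 0 :=
  Action.hom_ext _ _ <| AddCommGrpCat.hom_ext <| AddMonoidHom.ext fun a ↦ funext fun _ ↦
    sub_self (a : A)

lemma exists_coindDiff_eq (f : ℤ → A) : ∃ g : ℤ → A, ∀ n, g (n + 1) - g n = f n := by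
  -- The antiderivative vanishing at `0`, as a signed sum between `0` and `n`; one of the two
  -- intervals is always empty.
  refine ⟨fun n ↦ ∑ i ∈ Finset.Ico 0 n, f i - ∑ i ∈ Finset.Ico n 0, f i, fun n ↦ ?_⟩
  rcases lt_or_ge n 0 with hn | hn
  · have h1 : Finset.Ico 0 (n + 1) = ∅ := Finset.Ico_eq_empty (by lia)
    have h2 : Finset.Ico 0 n = ∅ := Finset.Ico_eq_empty (by lia)
    have h3 : Finset.Ico n 0 = insert n (Finset.Ico (n + 1) 0) := by
      ext i; simp only [Finset.mem_Ico, Finset.mem_insert]; lia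
    simp only [h1, h2, h3]
    rw [Finset.sum_insert (by simp)]
    simp
  · have h1 : Finset.Ico (n + 1) 0 = ∅ := Finset.Ico_eq_empty (by lia)
    have h2 : Finset.Ico n 0 = ∅ := Finset.Ico_eq_empty (by lia)
    have h3 : Finset.Ico 0 (n + 1) = insert n (Finset.Ico 0 n) := by
      ext i; simp only [Finset.mem_Ico, Finset.mem_insert]; lia
    simp only [h1, h2, h3]
    rw [Finset.sum_insert (by simp)]
    simp

/-- Coinduction from the trivial group is right adjoint to the forgetful functor: evaluation at `0`
turns equivariant maps into `ℤ → A` into additive maps into `A`. Divisible groups are injective, and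
a right adjoint of an exact functor preserves injectives. -/
instance injective_coind [DivisibleBy A ℤ] : Injective (coind k K A) where
  factors {X Y} g i _ := by
    have : Mono i.hom := inferInstanceAs (Mono ((Action.forget _ _).map i))
    let ev : (coind k K A).V ⟶ AddCommGrpCat.of A :=
      AddCommGrpCat.ofHom (AddMonoidHom.mk' (fun f : ℤ → A ↦ f 0) fun _ _ ↦ rfl)
    let h : Y.V ⟶ AddCommGrpCat.of A := Injective.factorThru (g.hom ≫ ev) i.hom
    have hh (x : X.V) : h (i.hom x) = (g.hom x : ℤ → A) 0 :=
      ConcreteCategory.congr_hom (Injective.comp_factorThru (g.hom ≫ ev) i.hom) x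
    -- The equivariant map that corresponds to `h` under the adjunction.
    refine ⟨mkHom (AddMonoidHom.mk' (fun y n ↦ h (act Y (frobW k K ^ n) y)) fun y z ↦ ?_) ?_, ?_⟩
    · funext n
      exact (congrArg h (map_add _ _ _)).trans (map_add _ _ _)
    · intro g y
      funext n
      change h (act Y (frobW k K ^ n) (act Y g y)) = h (act Y (frobW k K ^ (n + frobLog g)) y)
      rw [← act_mul, zpow_add, zpow_frobLog]
    · refine Action.hom_ext _ _ <| AddCommGrpCat.hom_ext <| AddMonoidHom.ext fun x ↦
        funext fun n ↦ ?_
      change h (act Y (frobW k K ^ n) (i.hom x)) = (g.hom x : ℤ → A) n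
      rw [← hom_act, hh, hom_act]
      change (g.hom x : ℤ → A) (0 + frobLog _) = _
      rw [frobLog_zpow, zero_add]

/-- The forgetful functor from `G`-modules to abelian groups. -/
noncomputable abbrev forgetG : GMod k K ⥤ AddCommGrpCat.{0} := Action.forget _ _

lemma shortExact_of_forgetG (S : ShortComplex (GMod k K))
    (h₁ : Function.Injective ((forgetG k K).map S.f))
    (h₂ : Function.Exact ((forgetG k K).map S.f) ((forgetG k K).map S.g))
    (h₃ : Function.Surjective ((forgetG k K).map S.g)) : S.ShortExact := by
  refine ShortExact.reflects_shortExact_of_faithful (forgetG k K) ?_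
  exact { exact := (ShortComplex.ab_exact_iff_function_exact _).2 h₂
          mono_f := (AddCommGrpCat.mono_iff_injective _).2 h₁
          epi_g := (AddCommGrpCat.epi_iff_surjective _).2 h₃ }

/-- Kernels and cokernels of discrete modules may be formed in all modules over the Galois group.
Together with the next instance this allows quasi-isomorphisms of discrete modules to be tested on
underlying groups. -/
instance : (isDiscrete k K).ι.PreservesHomology where
  preservesKernels _ _ f := by
    have := (isDiscrete k K).preservesKernels_ι
    infer_instance
  preservesCokernels _ _ f := by
    have := (isDiscrete k K).preservesCokernels_ι
    infer_instance

instance : (forgetDisc k K).PreservesHomology :=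
  have := (isDiscrete k K).ι.preservesFiniteLimits_of_preservesHomology
  have := (isDiscrete k K).ι.preservesFiniteColimits_of_preservesHomology
  have := comp_preservesFiniteLimits (isDiscrete k K).ι
    (Action.forget AddCommGrpCat.{0} Gal(K/k))
  have := comp_preservesFiniteColimits (isDiscrete k K).ι
    (Action.forget AddCommGrpCat.{0} Gal(K/k))
  inferInstance

/-- The sequence of modules of functions induced by `0 → ℤ → ℚ → ℚ/ℤ → 0`. -/
noncomputable def coindSeq : ShortComplex (GMod k K) :=
  ShortComplex.mk (coindMap k K (Int.castAddHom ℚ)) (coindMap k K projQZ)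
    (Action.hom_ext _ _ <| AddCommGrpCat.hom_ext <| AddMonoidHom.ext fun f ↦ funext fun n ↦
      (projQZ_eq_zero_iff _).2 ⟨(f : ℤ → ℤ) n, rfl⟩)

lemma coindSeq_shortExact : (coindSeq k K).ShortExact := by
  refine shortExact_of_forgetG k K _ ?_ ?_ ?_
  · intro f g h
    exact funext fun n ↦ Int.cast_injective (α := ℚ) (congrFun h n)
  · intro f
    constructor
    · intro h
      choose g hg using fun n ↦ (projQZ_eq_zero_iff _).1 (congrFun h n)
      exact ⟨g, funext hg⟩
    · rintro ⟨g, rfl⟩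
      exact funext fun n ↦ (projQZ_eq_zero_iff _).2 ⟨(g : ℤ → ℤ) n, rfl⟩
  · intro f
    choose g hg using fun n ↦ QuotientAddGroup.mk_surjective ((f : ℤ → QZ) n)
    exact ⟨g, funext hg⟩

/-- The endomorphism of `coindSeq` given by the difference operators. -/
noncomputable def coindSeqDiff : coindSeq k K ⟶ coindSeq k K where
  τ₁ := coindDiff k K ℤ
  τ₂ := coindDiff k K ℚ
  τ₃ := coindDiff k K QZ
  comm₁₂ := coindDiff_coindMap k K _
  comm₂₃ := coindDiff_coindMap k K _

open CochainComplex HomologicalComplex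

/-- The resolution `(ℤ → A) ⟶ (ℤ → A)`, `f ↦ φ f - f`, of the `G`-module `A` with trivial action. -/
noncomputable def coindComplex : CochainComplex (GMod k K) ℤ :=
  double (coindDiff k K A) rel_zero_one

/-- `coindComplex` as a two-term complex. -/
noncomputable def coindTwoTerm : TwoTerm (coindComplex k K A) (coindDiff k K A) := .double _ _

instance : (coindComplex k K A).IsStrictlyGE 0 := (coindTwoTerm k K A).isStrictlyGE

instance [DivisibleBy A ℤ] (i : ℤ) : Injective ((coindComplex k K A).X i) := by
  by_cases hi₀ : i = 0
  · subst hi₀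
    exact Injective.of_iso (coindTwoTerm k K A).iso₀.symm inferInstance
  by_cases hi₁ : i = 1
  · subst hi₁
    exact Injective.of_iso (coindTwoTerm k K A).iso₁.symm inferInstance
  · exact ((coindTwoTerm k K A).isZero i hi₀ hi₁).injective

/-- The map from the module `A` with trivial action to its resolution. -/
noncomputable def constToCoindComplex :
    (HomologicalComplex.single _ (ComplexShape.up ℤ) 0).obj (constG k K A) ⟶ coindComplex k K A :=
  (TwoTerm.single (constG k K A) (isZero_zero _)).hom (coindTwoTerm k K A)
    (constToCoind k K A) 0 (by rw [comp_zero, constToCoind_coindDiff])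

/-- A function equal to its translate by `1` is constant, and every function has an antiderivative.
Divisibility of `A` plays no role here. -/
instance quasiIso_constToCoindComplex : QuasiIso (constToCoindComplex k K A) := by
  refine TwoTerm.quasiIso (forgetG k K) (TwoTerm.single (constG k K A) (isZero_zero _))
    (coindTwoTerm k K A) _ (constToCoind k K A) 0 (TwoTerm.hom_f_zero_iso₀ ..)
    (TwoTerm.hom_f_one_iso₁ ..) ?_ ?_ ?_ ?_
  · intro x _ hx
    exact congrFun hx 0
  · intro f hf
    have hf (n : ℤ) : (f : ℤ → A) (n + 1) = (f : ℤ → A) n := sub_eq_zero.1 (congrFun hf n)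
    have h0 (n : ℤ) : (f : ℤ → A) n = (f : ℤ → A) 0 := by
      induction n with
      | zero => rfl
      | succ i hi => rw [hf, hi]
      | pred i hi => rw [← hi, ← hf, sub_add_cancel]
    exact ⟨(f : ℤ → A) 0, by rw [Functor.map_zero]; rfl, funext fun n ↦ (h0 n).symm⟩
  · intro x y _
    have := AddCommGrpCat.subsingleton_of_isZero ((forgetG k K).map_isZero (isZero_zero _))
    exact ⟨0, Subsingleton.elim _ _⟩
  · intro f
    -- The sign comes from the form of the surjectivity condition, `a₁ x = z + g y`, used with `x =
    -- 0`.
    obtain ⟨g, hg⟩ := exists_coindDiff_eq A fun n ↦ -(f : ℤ → A) n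
    refine ⟨0, g, ?_⟩
    rw [map_zero]
    refine funext fun n ↦ ?_
    change 0 = (f : ℤ → A) n + (g (n + 1) - g n)
    rw [hg, add_neg_cancel]

variable {A B} in
/-- The map of resolutions induced by a homomorphism of groups. -/
noncomputable def coindComplexMap (p : A →+ B) : coindComplex k K A ⟶ coindComplex k K B :=
  (coindTwoTerm k K A).hom (coindTwoTerm k K B) (coindMap k K p) (coindMap k K p)
    (coindDiff_coindMap k K p)

/-- The sequence of resolutions induced by `0 → ℤ → ℚ → ℚ/ℤ → 0`. -/
noncomputable def coindComplexSeq : ShortComplex (CochainComplex (GMod k K) ℤ) :=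
  ShortComplex.mk (coindComplexMap k K (Int.castAddHom ℚ)) (coindComplexMap k K projQZ) (by
    have h : coindMap k K (Int.castAddHom ℚ) ≫ coindMap k K projQZ = 0 := (coindSeq k K).zero
    refine (coindTwoTerm k K ℤ).hom_ext ?_ ?_
    · rw [comp_f, coindComplexMap, coindComplexMap, TwoTerm.hom_f_zero, TwoTerm.hom_f_zero]
      simp [reassoc_of% h]
    · rw [comp_f, coindComplexMap, coindComplexMap, TwoTerm.hom_f_one, TwoTerm.hom_f_one]
      simp [reassoc_of% h])

/-- In degrees 0 and 1 the sequence of complexes is `coindSeq`, so one exactness statement about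
modules suffices. It is used for the identity and for `γ_*`. -/
lemma coindComplexSeq_map_shortExact {E : Type*} [Category* E] [Abelian E] (F : GMod k K ⥤ E)
    [F.Additive] (hF : ((coindSeq k K).map F).ShortExact) :
    ((coindComplexSeq k K).map (F.mapHomologicalComplex (ComplexShape.up ℤ))).ShortExact := by
  have h₀ {A B : Type} [AddCommGroup A] [AddCommGroup B] (p : A →+ B) :=
    congrArg F.map (TwoTerm.hom_f_zero_iso₀ (coindTwoTerm k K A) (coindTwoTerm k K B)
      (coindMap k K p) (coindMap k K p) (coindDiff_coindMap k K p))
  have h₁ {A B : Type} [AddCommGroup A] [AddCommGroup B] (p : A →+ B) :=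
    congrArg F.map (TwoTerm.hom_f_one_iso₁ (coindTwoTerm k K A) (coindTwoTerm k K B)
      (coindMap k K p) (coindMap k K p) (coindDiff_coindMap k K p))
  simp only [F.map_comp] at h₀ h₁
  exact TwoTerm.shortExact (F.mapShortComplex.map (coindSeqDiff k K))
    ((coindTwoTerm k K ℤ).map F) ((coindTwoTerm k K ℚ).map F) ((coindTwoTerm k K QZ).map F)
    (h₀ _) (h₁ _) (h₀ _) (h₁ _) hF hF

end

end WeilEtale

/-! ### Periodic functions: antiderivatives, mean values and the transgression. -/

namespace WeilEtale

open CategoryTheory Limits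

/-- The sum of a periodic function over a period does not change under translation. -/
lemma sum_range_periodic_add {A : Type*} [AddCommGroup A] {f : ℤ → A} {m : ℕ}
    (hf : ∀ n, f (n + m) = f n) (a : ℤ) :
    ∑ i ∈ Finset.range m, f (a + i) = ∑ i ∈ Finset.range m, f i := by
  have h (a : ℤ) : ∑ i ∈ Finset.range m, f (a + 1 + i) = ∑ i ∈ Finset.range m, f (a + i) := by
    have h1 := Finset.sum_range_succ (fun i : ℕ ↦ f (a + i)) m
    have h2 := Finset.sum_range_succ' (fun i : ℕ ↦ f (a + i)) m
    rw [h1, hf] at h2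
    simp only [Nat.cast_zero, add_zero] at h2
    rw [add_left_inj] at h2
    rw [h2]
    exact Finset.sum_congr rfl fun i _ ↦ by push_cast; ring_nf
  induction a with
  | zero => simp
  | succ n hn => rw [h, hn]
  | pred n hn => rw [← hn, ← h, sub_add_cancel]

lemma sum_range_periodic_mul {A : Type*} [AddCommGroup A] {f : ℤ → A} {m : ℕ}
    (hf : ∀ n, f (n + m) = f n) (a : ℕ) :
    ∑ i ∈ Finset.range (m * a), f i = a • ∑ i ∈ Finset.range m, f i := by
  induction a with
  | zero => simp
  | succ a ih =>
    rw [Nat.mul_succ, Finset.sum_range_add, ih, succ_nsmul]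
    congr 1
    rw [← sum_range_periodic_add hf (m * a : ℕ)]
    simp

section

variable (k : Type v) (K : Type u) [Field k] [Fintype k] [Field K] [Algebra k K]
  [IsAlgClosed K] [Algebra.IsAlgebraic k K] {A B : Type} [AddCommGroup A] [AddCommGroup B]

lemma act_coind_pow_eq_iff (m : ℕ) (f : ℤ → A) :
    act (coind k K A) (frobW k K ^ m) f = f ↔ ∀ n, f (n + m) = f n := by
  refine funext_iff.trans (forall_congr' fun n ↦ ?_)
  rw [act_coind, frobLog_pow]

lemma mem_finPart_coind_iff (f : ℤ → A) :
    f ∈ finPart (coind k K A) ↔ ∃ m : ℕ, 0 < m ∧ ∀ n, f (n + m) = f n :=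
  exists_congr fun m ↦ and_congr_right fun _ ↦ act_coind_pow_eq_iff k K m f

variable (A) in
/-- The group of periodic functions `ℤ → A`, as the group underlying `γ_*` of the module of all
functions. -/
abbrev Per : Type := finPart (coind k K A)

variable {k K}

/-- The function given by an element of `Per`. -/
def Per.fn (f : Per k K A) : ℤ → A := f.1

lemma Per.ext {f g : Per k K A} (h : ∀ n, f.fn n = g.fn n) : f = g := Subtype.ext (funext h)

lemma Per.fn_add (f g : Per k K A) (n : ℤ) : (f + g).fn n = f.fn n + g.fn n := rfl

/-- A periodic function as an element of `Per`. -/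
def Per.mk (f : ℤ → A) (m : ℕ) (hm : 0 < m) (hf : ∀ n, f (n + m) = f n) : Per k K A :=
  ⟨f, (mem_finPart_coind_iff k K f).2 ⟨m, hm, hf⟩⟩

lemma Per.fn_mk (f : ℤ → A) (m : ℕ) (hm : 0 < m) (hf : ∀ n, f (n + m) = f n) (n : ℤ) :
    (Per.mk f m hm hf : Per k K A).fn n = f n := rfl

/-- The constant functions. -/
def Per.const (a : A) : Per k K A := .mk (fun _ ↦ a) 1 one_pos fun _ ↦ rfl

lemma Per.exists_period (f : Per k K A) : ∃ m : ℕ, 0 < m ∧ ∀ n, f.fn (n + m) = f.fn n :=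
  (mem_finPart_coind_iff k K f.1).1 f.2

variable (k K A) in
/-- The difference operator on periodic functions. -/
noncomputable def Per.diff : Per k K A →+ Per k K A := finPartMap (coindDiff k K A)

lemma Per.fn_diff (f : Per k K A) (n : ℤ) : (Per.diff k K A f).fn n = f.fn (n + 1) - f.fn n := rfl

variable (k K) in
/-- The map on periodic functions induced by a homomorphism. -/
noncomputable def Per.map (p : A →+ B) : Per k K A →+ Per k K B := finPartMap (coindMap k K p)

lemma Per.fn_map (p : A →+ B) (f : Per k K A) (n : ℤ) : (Per.map k K p f).fn n = p (f.fn n) := rfl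

lemma Per.diff_eq_zero_iff (f : Per k K A) : Per.diff k K A f = 0 ↔ f = Per.const (f.fn 0) := by
  constructor
  · intro h
    have h (n : ℤ) : f.fn (n + 1) = f.fn n := sub_eq_zero.1 (congrArg (fun g ↦ Per.fn g n) h)
    refine Per.ext fun n ↦ ?_
    change f.fn n = f.fn 0
    induction n with
    | zero => rfl
    | succ i hi => rw [h, hi]
    | pred i hi => rw [← hi, ← h, sub_add_cancel]
  · intro h
    refine Per.ext fun n ↦ ?_
    rw [Per.fn_diff, h]
    exact sub_self _

/-- An antiderivative grows by the sum over one period each time the argument increases by `m`; if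
that sum vanishes, it is periodic. -/
lemma Per.exists_diff_eq (f : Per k K A) {m : ℕ} (hm : 0 < m) (hf : ∀ n, f.fn (n + m) = f.fn n)
    (h : ∑ i ∈ Finset.range m, f.fn i = 0) : ∃ g, Per.diff k K A g = f := by
  obtain ⟨g, hg⟩ := exists_coindDiff_eq A f.fn
  have hsum (n : ℤ) (j : ℕ) : g (n + j) = g n + ∑ i ∈ Finset.range j, f.fn (n + i) := by
    induction j with
    | zero => simp
    | succ j ih => rw [Finset.sum_range_succ, ← hg, ← add_assoc, ← ih]; push_cast; simp [add_assoc]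
  exact ⟨.mk g m hm fun n ↦ by rw [hsum, sum_range_periodic_add hf, h, add_zero], Per.ext hg⟩

/-- The mean value of a periodic function. -/
noncomputable def Per.meanFun (f : Per k K ℚ) : ℚ :=
  (∑ i ∈ Finset.range f.exists_period.choose, f.fn i) / f.exists_period.choose

/-- The mean does not depend on the chosen period: for periods `m` and `m'`, the sum over `m * m'`
terms is a multiple of both sums. -/
lemma Per.meanFun_eq (f : Per k K ℚ) {m : ℕ} (hm : 0 < m) (hf : ∀ n, f.fn (n + m) = f.fn n) :
    f.meanFun = (∑ i ∈ Finset.range m, f.fn i) / m := by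
  obtain ⟨hm', hf'⟩ := f.exists_period.choose_spec
  rw [meanFun]
  set m' := f.exists_period.choose
  have h1 := sum_range_periodic_mul hf m'
  have h2 := sum_range_periodic_mul hf' m
  rw [mul_comm, h2, nsmul_eq_mul, nsmul_eq_mul] at h1
  have : (m : ℚ) ≠ 0 := by exact_mod_cast hm.ne'
  have : (m' : ℚ) ≠ 0 := by exact_mod_cast hm'.ne'
  field_simp
  linarith

lemma Per.exists_common_period {A B : Type} [AddCommGroup A] [AddCommGroup B] (f : Per k K A)
    (g : Per k K B) :
    ∃ m : ℕ, 0 < m ∧ (∀ n, f.fn (n + m) = f.fn n) ∧ ∀ n, g.fn (n + m) = g.fn n := by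
  obtain ⟨m, hm, hf⟩ := f.exists_period
  obtain ⟨m', hm', hg⟩ := g.exists_period
  have hf := Function.Periodic.int_mul hf m'
  have hg := Function.Periodic.int_mul hg m
  refine ⟨m * m', Nat.mul_pos hm hm', fun n ↦ ?_, fun n ↦ ?_⟩
  · rw [← hf n]; push_cast; ring_nf
  · rw [← hg n]; push_cast; ring_nf

variable (k K) in
/-- The mean value of a periodic function, as a homomorphism. -/
noncomputable def Per.mean : Per k K ℚ →+ ℚ :=
  AddMonoidHom.mk' Per.meanFun fun f g ↦ by
    obtain ⟨m, hm, hf, hg⟩ := Per.exists_common_period f g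
    rw [f.meanFun_eq hm hf, g.meanFun_eq hm hg, (f + g).meanFun_eq hm fun n ↦ by
      rw [Per.fn_add, Per.fn_add, hf, hg], ← add_div, ← Finset.sum_add_distrib]
    rfl

lemma Per.mean_eq (f : Per k K ℚ) {m : ℕ} (hm : 0 < m) (hf : ∀ n, f.fn (n + m) = f.fn n) :
    Per.mean k K f = (∑ i ∈ Finset.range m, f.fn i) / m := f.meanFun_eq hm hf

lemma Per.mean_const (a : ℚ) : Per.mean k K (Per.const a) = a := by
  rw [Per.mean_eq _ one_pos fun _ ↦ rfl]
  simp [Per.const, Per.fn_mk]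

lemma Per.mean_diff (f : Per k K ℚ) : Per.mean k K (Per.diff k K ℚ f) = 0 := by
  obtain ⟨m, hm, hf, hg⟩ := Per.exists_common_period f (Per.diff k K ℚ f)
  rw [Per.mean_eq _ hm hg]
  simp only [Per.fn_diff, Finset.sum_sub_distrib, add_comm _ (1 : ℤ), sum_range_periodic_add hf,
    sub_self, zero_div]

lemma Per.exists_diff_eq_of_mean_eq_zero (f : Per k K ℚ) (h : Per.mean k K f = 0) :
    ∃ g, Per.diff k K ℚ g = f := by
  obtain ⟨m, hm, hf⟩ := f.exists_period
  refine f.exists_diff_eq hm hf ?_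
  rw [Per.mean_eq f hm hf] at h
  have : (m : ℚ) ≠ 0 := by exact_mod_cast hm.ne'
  simpa [this] using h

variable (k K) in
/-- The mean value of an integral periodic function. -/
noncomputable def Per.meanInt : Per k K ℤ →+ ℚ :=
  (Per.mean k K).comp (Per.map k K (Int.castAddHom ℚ))

lemma Per.meanInt_eq (f : Per k K ℤ) {m : ℕ} (hm : 0 < m) (hf : ∀ n, f.fn (n + m) = f.fn n) :
    Per.meanInt k K f = ((∑ i ∈ Finset.range m, f.fn i : ℤ) : ℚ) / m := by
  refine (Per.mean_eq _ hm fun n ↦ ?_).trans ?_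
  · rw [Per.fn_map, hf]; rfl
  · rw [Int.cast_sum]
    rfl

lemma Per.meanInt_const (a : ℤ) : Per.meanInt k K (Per.const a) = a := Per.mean_const (a : ℚ)

lemma Per.map_diff (p : A →+ B) (f : Per k K A) :
    Per.map k K p (Per.diff k K A f) = Per.diff k K B (Per.map k K p f) :=
  Per.ext fun _ ↦ map_sub p _ _

lemma Per.meanInt_diff (f : Per k K ℤ) : Per.meanInt k K (Per.diff k K ℤ f) = 0 := by
  change Per.mean k K (Per.map k K _ _) = 0
  rw [Per.map_diff, Per.mean_diff]

/-- The antiderivative of an integral function is integral, so vanishing of the rational mean is the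
only obstruction even over `ℤ`. -/
lemma Per.exists_diff_eq_of_meanInt_eq_zero (f : Per k K ℤ) (h : Per.meanInt k K f = 0) :
    ∃ g, Per.diff k K ℤ g = f := by
  obtain ⟨m, hm, hf⟩ := f.exists_period
  refine f.exists_diff_eq hm hf ?_
  rw [Per.meanInt_eq f hm hf] at h
  have : (m : ℚ) ≠ 0 := by exact_mod_cast hm.ne'
  have := (div_eq_zero_iff.1 h).resolve_right this
  exact_mod_cast this

/-- Arbitrary periods allow arbitrary denominators, which is why `ℚ` and not `ℤ` appears in degree
1: the function with value `t.num` on the multiples of `t.den`, and zero elsewhere, has mean `t`. -/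
lemma Per.exists_meanInt_eq (t : ℚ) : ∃ f, Per.meanInt k K f = t := by
  have hf (n : ℤ) : (if (t.den : ℤ) ∣ n + t.den then t.num else 0) =
      if (t.den : ℤ) ∣ n then t.num else 0 := by
    simp
  refine ⟨.mk (fun n ↦ if (t.den : ℤ) ∣ n then t.num else 0) t.den t.den_pos hf, ?_⟩
  refine (Per.meanInt_eq (.mk (fun n ↦ if (t.den : ℤ) ∣ n then t.num else 0) t.den t.den_pos hf)
    t.den_pos hf).trans ?_
  simp only [Per.fn_mk]
  rw [Finset.sum_eq_single 0]
  · simp [Rat.num_div_den]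
  · intro i hi hi0
    rw [if_neg]
    intro h
    exact absurd (Nat.le_of_dvd (Nat.pos_of_ne_zero hi0) (Int.natCast_dvd_natCast.1 h))
      (not_le.2 (Finset.mem_range.1 hi))
  · intro h
    exact absurd (Finset.mem_range.2 t.den_pos) h

variable (k K) in
/-- There is a homomorphism `r` with `r (φ f - f)` equal to the class of the mean value of `f`. -/
lemma Per.exists_transgression : ∃ r : Per k K ℤ →+ QZ,
    ∀ f, r (Per.diff k K ℤ f) = projQZ (Per.meanInt k K f) := by
  -- The quotient by the kernel stands for the image of the difference operator. The class of the
  -- mean descends to it, since the kernel consists of integral constants.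
  let s : (Per k K ℤ ⧸ (Per.diff k K ℤ).ker) →+ QZ :=
    QuotientAddGroup.lift _ (projQZ.comp (Per.meanInt k K)) (by
      intro f hf
      rw [(Per.diff_eq_zero_iff f).1 hf]
      change projQZ (Per.meanInt k K _) = 0
      rw [Per.meanInt_const]
      exact (projQZ_eq_zero_iff _).2 ⟨_, rfl⟩)
  let i : AddCommGrpCat.of (Per k K ℤ ⧸ (Per.diff k K ℤ).ker) ⟶ AddCommGrpCat.of (Per k K ℤ) :=
    AddCommGrpCat.ofHom (QuotientAddGroup.kerLift (Per.diff k K ℤ))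
  have : Mono i := (AddCommGrpCat.mono_iff_injective i).2
    (QuotientAddGroup.kerLift_injective (Per.diff k K ℤ))
  -- Divisibility of `ℚ/ℤ` extends the map from that image to all periodic functions. The extension
  -- is not canonical.
  refine ⟨(Injective.factorThru (AddCommGrpCat.ofHom s) i).hom, fun f ↦ ?_⟩
  exact ConcreteCategory.congr_hom (Injective.comp_factorThru (AddCommGrpCat.ofHom s) i)
    (QuotientAddGroup.mk f)

variable (k K) in
/-- A choice of a homomorphism as in `Per.exists_transgression`. -/
noncomputable def Per.transgression : Per k K ℤ →+ QZ := (Per.exists_transgression k K).choose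

lemma Per.transgression_diff (f : Per k K ℤ) :
    Per.transgression k K (Per.diff k K ℤ f) = projQZ (Per.meanInt k K f) :=
  (Per.exists_transgression k K).choose_spec f

/-- The translate of a periodic function. -/
def Per.shift (f : Per k K A) (i : ℕ) : Per k K A :=
  ⟨fun n ↦ f.fn (n + i), (mem_finPart_coind_iff k K _).2 (by
    obtain ⟨m, hm, hf⟩ := f.exists_period
    exact ⟨m, hm, fun n ↦ by rw [add_right_comm, hf]⟩)⟩

lemma Per.fn_shift (f : Per k K A) (i : ℕ) (n : ℤ) : (f.shift i).fn n = f.fn (n + i) := rfl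

/-- The identity `φ f = f + (φ f - f)`, through which the effect of `φ ^ i` on means and on the
transgression is found by induction. -/
lemma Per.shift_succ (f : Per k K A) (i : ℕ) :
    f.shift (i + 1) = f.shift i + Per.diff k K A (f.shift i) :=
  Per.ext fun n ↦ by
    rw [Per.fn_add, Per.fn_diff, add_sub_cancel]
    simp only [Per.fn_shift]
    push_cast
    ring_nf

lemma Per.shift_zero (f : Per k K A) : f.shift 0 = f := Per.ext fun n ↦ by simp [Per.fn_shift]

lemma Per.mean_shift (f : Per k K ℚ) (i : ℕ) : Per.mean k K (f.shift i) = Per.mean k K f := by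
  induction i with
  | zero => rw [Per.shift_zero]
  | succ i ih => rw [Per.shift_succ, map_add, Per.mean_diff, add_zero, ih]

lemma Per.meanInt_shift (f : Per k K ℤ) (i : ℕ) :
    Per.meanInt k K (f.shift i) = Per.meanInt k K f := by
  induction i with
  | zero => rw [Per.shift_zero]
  | succ i ih => rw [Per.shift_succ, map_add, Per.meanInt_diff, add_zero, ih]

/-- Each translation adds the transgression of a difference, that is, the class of the mean, and the
mean is unchanged by translation. -/
lemma Per.transgression_shift (f : Per k K ℤ) (i : ℕ) :
    Per.transgression k K (f.shift i) =
      Per.transgression k K f + i • projQZ (Per.meanInt k K f) := by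
  induction i with
  | zero => rw [Per.shift_zero, zero_nsmul, add_zero]
  | succ i ih => rw [Per.shift_succ, map_add, Per.transgression_diff, ih, Per.meanInt_shift,
      succ_nsmul, add_assoc]

lemma Per.galAct_eq_shift (f : Per k K A) (g : Gal(K/k)) {m i : ℕ} (hm : 0 < m)
    (hf : ∀ n, f.fn (n + m) = f.fn n) (hi : FrobCongr g m i) :
    galAct (coind k K A) g f = f.shift i := by
  refine Subtype.ext ((galAct_eq _ hm ((act_coind_pow_eq_iff k K m _).2 hf) hi).trans ?_)
  refine funext fun n ↦ ?_
  refine (act_coind k K A _ f.fn n).trans ?_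
  rw [frobLog_pow]
  rfl

lemma Per.mean_galAct (f : Per k K ℚ) (g : Gal(K/k)) :
    Per.mean k K (galAct (coind k K ℚ) g f) = Per.mean k K f := by
  obtain ⟨m, hm, hf⟩ := f.exists_period
  obtain ⟨i, hi⟩ := exists_frobCongr g hm
  rw [f.galAct_eq_shift g hm hf hi, Per.mean_shift]

lemma Per.meanInt_galAct (f : Per k K ℤ) (g : Gal(K/k)) :
    Per.meanInt k K (galAct (coind k K ℤ) g f) = Per.meanInt k K f := by
  obtain ⟨m, hm, hf⟩ := f.exists_period
  obtain ⟨i, hi⟩ := exists_frobCongr g hm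
  rw [f.galAct_eq_shift g hm hf hi, Per.meanInt_shift]

/-- With `Per.meanInt_galAct` this is the equivariance of the map to `M`; the unipotent action on
`M` arises here. -/
lemma Per.transgression_galAct (f : Per k K ℤ) (g : Gal(K/k)) :
    Per.transgression k K (galAct (coind k K ℤ) g f) =
      Per.transgression k K f + galSMul g (projQZ (Per.meanInt k K f)) := by
  obtain ⟨m, hm, hf⟩ := f.exists_period
  obtain ⟨i, hi⟩ := exists_frobCongr g hm
  rw [f.galAct_eq_shift g hm hf hi, Per.transgression_shift, galSMul_eq hm _ hi]
  -- `galSMul_eq` requires the class of the mean to be killed by the period `m`: indeed `m` times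
  -- the mean is the integral sum over a period.
  rw [← map_nsmul, projQZ_eq_zero_iff, Per.meanInt_eq f hm hf]
  refine ⟨∑ i ∈ Finset.range m, f.fn i, ?_⟩
  have : (m : ℚ) ≠ 0 := by exact_mod_cast hm.ne'
  rw [nsmul_eq_mul]
  field_simp

end

end WeilEtale

/-! ### The functor `γ_*` on the resolutions, compared with `ℤᶜ` and `ℚ ⊕ ℚ[-1]`. -/

namespace WeilEtale

open CategoryTheory Limits

section

variable (k : Type v) (K : Type u) [Field k] [Fintype k] [Field K] [Algebra k K]
  [IsAlgClosed K] [Algebra.IsAlgebraic k K] (A : Type) [AddCommGroup A]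

variable {A} in
lemma Per.exists_map_eq {B : Type} [AddCommGroup B] (p : A →+ B) (f : Per k K B)
    (hp : ∀ n, ∃ a, p a = f.fn n) : ∃ g, Per.map k K p g = f := by
  obtain ⟨m, hm, hf⟩ := f.exists_period
  -- The preimage depends only on the value `b`, not on the argument `n`, so the lift keeps the
  -- period of `f`.
  let s (b : B) : A := Classical.epsilon fun a ↦ p a = b
  have hs (n : ℤ) : p (s (f.fn n)) = f.fn n := Classical.epsilon_spec (hp n)
  exact ⟨.mk (fun n ↦ s (f.fn n)) m hm fun n ↦ by rw [hf], Per.ext hs⟩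

/-- In general `γ_*` is only left exact. Here periodic functions lift to periodic functions by
lifting their values, so integral functions behave as an acyclic module. -/
lemma coindSeq_map_gammaStar_shortExact : ((coindSeq k K).map (gammaStar k K)).ShortExact := by
  refine shortExact_of_forget k K _ ?_ ?_ ?_
  · intro (f : Per k K ℤ) (g : Per k K ℤ) h
    exact Per.ext fun n ↦ Int.cast_injective (α := ℚ) (congrFun (congrArg Subtype.val h) n)
  · intro (f : Per k K ℚ)
    constructor
    · intro h
      exact Per.exists_map_eq k K (Int.castAddHom ℚ) f fun n ↦
        (projQZ_eq_zero_iff _).1 (congrFun (congrArg Subtype.val h) n)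
    · rintro ⟨g, rfl⟩
      exact Per.ext fun n ↦ (projQZ_eq_zero_iff _).2 ⟨Per.fn g n, rfl⟩
  · intro (f : Per k K QZ)
    exact Per.exists_map_eq k K projQZ f fun n ↦ QuotientAddGroup.mk_surjective (f.fn n)

/-- The mean value as a homomorphism of modules. -/
noncomputable def meanHom : (gammaStar k K).obj (coind k K ℚ) ⟶ const k K ℚ :=
  ObjectProperty.homMk (mkHom (Per.mean k K) fun g f ↦ Per.mean_galAct f g)

/-- The mean value of integral functions as a homomorphism of modules. -/
noncomputable def meanIntHom : (gammaStar k K).obj (coind k K ℤ) ⟶ const k K ℚ :=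
  ObjectProperty.homMk (mkHom (Per.meanInt k K) fun g f ↦ Per.meanInt_galAct f g)

/-- The homomorphism from `γ_*` of the integral functions to `M` given by the transgression and the
mean value. -/
noncomputable def transgressionHom : (gammaStar k K).obj (coind k K ℤ) ⟶ modM k K :=
  ObjectProperty.homMk (mkHom ((Per.transgression k K).prod (Per.meanInt k K)) fun g f ↦
    Prod.ext (Per.transgression_galAct f g) (Per.meanInt_galAct f g))

lemma DiscMod.hom_ext {V W : DiscMod k K} {f g : V ⟶ W}
    (h : ∀ x, (forgetDisc k K).map f x = (forgetDisc k K).map g x) : f = g :=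
  ObjectProperty.hom_ext _ <| Action.hom_ext _ _ <| AddCommGrpCat.hom_ext <| AddMonoidHom.ext h

lemma map_coindDiff_transgressionHom :
    (gammaStar k K).map (coindDiff k K ℤ) ≫ transgressionHom k K =
      meanIntHom k K ≫ mapQM k K :=
  DiscMod.hom_ext k K fun f ↦ Prod.ext (Per.transgression_diff (k := k) (K := K) f)
    (Per.meanInt_diff (k := k) (K := K) f)

lemma map_coindDiff_meanHom :
    (gammaStar k K).map (coindDiff k K ℚ) ≫ meanHom k K = meanHom k K ≫ 0 :=
  DiscMod.hom_ext k K fun f ↦ Per.mean_diff (k := k) (K := K) f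

open CochainComplex HomologicalComplex

/-- `γ_*` of the resolution of the module `A`. -/
noncomputable abbrev gammaComplex : CochainComplex (DiscMod k K) ℤ :=
  ((gammaStar k K).mapHomologicalComplex (ComplexShape.up ℤ)).obj (coindComplex k K A)

/-- `gammaComplex` as a two-term complex. -/
noncomputable def gammaTwoTerm :
    TwoTerm (gammaComplex k K A) ((gammaStar k K).map (coindDiff k K A)) :=
  (coindTwoTerm k K A).map (gammaStar k K)

/-- `Zc` as a two-term complex. -/
noncomputable def twoTermZc : TwoTerm (Zc k K) (mapQM k K) := .double _ _

/-- The map from `γ_*` of the resolution of `ℤ` to `ℤᶜ`. -/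
noncomputable def gammaComplexToZc : gammaComplex k K ℤ ⟶ Zc k K :=
  (gammaTwoTerm k K ℤ).hom (twoTermZc k K) (meanIntHom k K) (transgressionHom k K)
    (map_coindDiff_transgressionHom k K)

/-- On both sides the cohomology is `ℤ` in degree 0 and `ℚ` in degree 1. The mean fixes constants
and, by `Per.exists_diff_eq_of_meanInt_eq_zero` and `Per.exists_meanInt_eq`, identifies the two
cokernels. -/
instance quasiIso_gammaComplexToZc : QuasiIso (gammaComplexToZc k K) := by
  refine TwoTerm.quasiIso (forgetDisc k K) (gammaTwoTerm k K ℤ) (twoTermZc k K) _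
    (meanIntHom k K) (transgressionHom k K) (TwoTerm.hom_f_zero_iso₀ ..)
    (TwoTerm.hom_f_one_iso₁ ..) ?_ ?_ ?_ ?_
  · intro (f : Per k K ℤ) hf hf'
    have hf := (Per.diff_eq_zero_iff f).1 hf
    have hf' : Per.meanInt k K f = 0 := hf'
    rw [hf, Per.meanInt_const] at hf'
    rw [hf, Int.cast_eq_zero.1 hf']
    rfl
  · intro (z : ℚ) hz
    obtain ⟨n, rfl⟩ := (projQZ_eq_zero_iff z).1 (congrArg Prod.fst hz)
    exact ⟨Per.const n, (Per.diff_eq_zero_iff _).2 rfl, Per.meanInt_const n⟩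
  · intro (f : Per k K ℤ) (y : ℚ) h
    exact Per.exists_diff_eq_of_meanInt_eq_zero f (congrArg Prod.snd h)
  · rintro ⟨(s : QZ), (t : ℚ)⟩
    obtain ⟨f, hf⟩ := Per.exists_meanInt_eq (k := k) (K := K) t
    -- Once the mean is `t`, the `ℚ/ℤ`-component is off by `r f - s`, which is the image of a
    -- rational number under the differential of `ℤᶜ`.
    obtain ⟨y, hy⟩ := QuotientAddGroup.mk_surjective (Per.transgression k K f - s)
    refine ⟨f, (y : ℚ), Prod.ext ?_ ?_⟩
    · change Per.transgression k K f = s + projQZ y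
      refine Eq.trans ?_ (congrArg (s + ·) hy.symm)
      exact (add_sub_cancel _ _).symm
    · exact hf.trans (add_zero t).symm

/-- The complex with terms `ℚ` in degrees `0` and `1` and zero differential. -/
noncomputable abbrev doubleQ : CochainComplex (DiscMod k K) ℤ :=
  HomologicalComplex.double (0 : const k K ℚ ⟶ const k K ℚ) rel_zero_one

/-- `doubleQ` as a two-term complex. -/
noncomputable def twoTermDoubleQ : TwoTerm (doubleQ k K) (0 : const k K ℚ ⟶ const k K ℚ) :=
  .double _ _

/-- The map from `γ_*` of the resolution of `ℚ` to `doubleQ` given by the mean value. -/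
noncomputable def gammaComplexToDoubleQ : gammaComplex k K ℚ ⟶ doubleQ k K :=
  (gammaTwoTerm k K ℚ).hom (twoTermDoubleQ k K) (meanHom k K) (meanHom k K)
    (map_coindDiff_meanHom k K)

instance quasiIso_gammaComplexToDoubleQ : QuasiIso (gammaComplexToDoubleQ k K) := by
  refine TwoTerm.quasiIso (forgetDisc k K) (gammaTwoTerm k K ℚ) (twoTermDoubleQ k K) _
    (meanHom k K) (meanHom k K) (TwoTerm.hom_f_zero_iso₀ ..)
    (TwoTerm.hom_f_one_iso₁ ..) ?_ ?_ ?_ ?_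
  · intro (f : Per k K ℚ) hf hf'
    have hf := (Per.diff_eq_zero_iff f).1 hf
    have hf' : Per.mean k K f = 0 := hf'
    rw [hf, Per.mean_const] at hf'
    rw [hf, hf']
    rfl
  · intro (z : ℚ) hz
    exact ⟨Per.const z, (Per.diff_eq_zero_iff _).2 rfl, Per.mean_const z⟩
  · intro (f : Per k K ℚ) (y : ℚ) h
    exact Per.exists_diff_eq_of_mean_eq_zero f h
  · intro (z : ℚ)
    exact ⟨Per.const z, (0 : ℚ), (Per.mean_const z).trans (add_zero z).symm⟩

end

/-! ### Computation of `Rγ_*` by the coinduced resolutions. -/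

section derived

variable (k : Type v) (K : Type u) [Field k] [Fintype k] [Field K] [Algebra k K]
  [IsAlgClosed K] [Algebra.IsAlgebraic k K] (A : Type) [AddCommGroup A]
  [HasDerivedCategory.{w₁} (GMod k K)] [HasDerivedCategory.{w₂} (DiscMod k K)]

lemma plus_coindComplex : CochainComplex.plus _ (coindComplex k K A) := ⟨0, inferInstance⟩

/-- The resolution of `A` as an object of the bounded below homotopy category. -/
noncomputable abbrev coindPlus : HomotopyCategory.Plus (GMod k K) :=
  (HomotopyCategory.Plus.quotient _).obj ⟨coindComplex k K A, plus_coindComplex k K A⟩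

/-- The map from `A` to its resolution in the bounded below homotopy category. -/
noncomputable def constToCoindPlus :
    (HomotopyCategory.Plus.singleFunctor (GMod k K) 0).obj (constG k K A) ⟶ coindPlus k K A :=
  ObjectProperty.homMk ((HomotopyCategory.quotient _ _).map (constToCoindComplex k K A))

instance isIso_Qh_map_constToCoindPlus :
    IsIso (DerivedCategory.Plus.Qh.map (constToCoindPlus k K A)) :=
  Localization.inverts DerivedCategory.Plus.Qh (HomotopyCategory.Plus.quasiIso _) _
    ((HomotopyCategory.quotient_map_mem_quasiIso_iff (constToCoindComplex k K A)).2
      (quasiIso_constToCoindComplex k K A))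

/-- The terms of this complex are not assumed injective; it is resolved by the injective complexes
for `ℚ` and `ℚ/ℤ`, exactly before and after `γ_*`. -/
instance isIso_unit_coindPlus_int :
    IsIso ((gammaStar k K).rightDerivedFunctorPlusUnit.app (coindPlus k K ℤ)) := by
  have : ∀ i, Injective ((coindComplexSeq k K).X₂.X i) := fun i ↦
    inferInstanceAs (Injective ((coindComplex k K ℚ).X i))
  have : ∀ i, Injective ((coindComplexSeq k K).X₃.X i) := fun i ↦
    inferInstanceAs (Injective ((coindComplex k K QZ).X i))
  have : (coindComplexSeq k K).X₂.IsStrictlyGE 0 :=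
    inferInstanceAs ((coindComplex k K ℚ).IsStrictlyGE 0)
  have : (coindComplexSeq k K).X₃.IsStrictlyGE 0 :=
    inferInstanceAs ((coindComplex k K QZ).IsStrictlyGE 0)
  have h := coindComplexSeq_map_shortExact k K (𝟭 _) (coindSeq_shortExact k K)
  exact (gammaStar k K).isIso_rightDerivedFunctorPlusUnit_app_of_shortExact (coindComplexSeq k K)
    h (coindComplexSeq_map_shortExact k K _ (coindSeq_map_gammaStar_shortExact k K)) _ 0

/-- The module `A` is isomorphic to its resolution in the derived category. -/
noncomputable def coindPlusIso : (DerivedCategory.Plus.singleFunctor (GMod k K) 0).obj (constG k K A) ≅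
    DerivedCategory.Plus.Qh.obj (coindPlus k K A) :=
  have := isIso_Qh_map_constToCoindPlus k K A
  @asIso _ _ _ _ (DerivedCategory.Plus.Qh.map (constToCoindPlus k K A)) this

/-- `Rγ_* A` is computed by `γ_*` of the resolution of `A`. -/
noncomputable def RgammaStarIso
    [IsIso ((gammaStar k K).rightDerivedFunctorPlusUnit.app (coindPlus k K A))] :
    RgammaStarConst k K A ≅ DerivedCategory.Q.obj (gammaComplex k K A) :=
  (RgammaStar k K).mapIso (coindPlusIso k K A) ≪≫
    (DerivedCategory.Plus.ι.mapIso
      (asIso ((gammaStar k K).rightDerivedFunctorPlusUnit.app (coindPlus k K A)))).symm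

/-- The map from `A` to `γ_*` of its resolution. -/
noncomputable def constToGammaComplex :
    (HomologicalComplex.single _ (ComplexShape.up ℤ) 0).obj (const k K A) ⟶ gammaComplex k K A :=
  (HomologicalComplex.single _ (ComplexShape.up ℤ) 0).map (constUnit k K A) ≫
    (HomologicalComplex.singleMapHomologicalComplex (gammaStar k K)
        (ComplexShape.up ℤ) 0).inv.app (constG k K A) ≫
    ((gammaStar k K).mapHomologicalComplex (ComplexShape.up ℤ)).map (constToCoindComplex k K A)

/-- Naturality of the unit along the resolution `A → coindComplex`: the unit at `A` is exchanged for
the unit at the resolution, which `RgammaStarIso` inverts. -/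
lemma unitConst_RgammaStarIso
    [IsIso ((gammaStar k K).rightDerivedFunctorPlusUnit.app (coindPlus k K A))] :
    unitConst k K A ≫ (RgammaStarIso k K A).hom =
      DerivedCategory.Q.map (constToGammaComplex k K A) := by
  have nat := congrArg DerivedCategory.Plus.ι.map
    ((gammaStar k K).rightDerivedFunctorPlusUnit.naturality (constToCoindPlus k K A))
  rw [Functor.map_comp, Functor.map_comp] at nat
  have hinv : DerivedCategory.Plus.ι.map
      ((gammaStar k K).rightDerivedFunctorPlusUnit.app (coindPlus k K A)) ≫
      (DerivedCategory.Plus.ι.mapIso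
        (asIso ((gammaStar k K).rightDerivedFunctorPlusUnit.app (coindPlus k K A)))).inv = 𝟙 _ :=
    (DerivedCategory.Plus.ι.mapIso
        (asIso ((gammaStar k K).rightDerivedFunctorPlusUnit.app (coindPlus k K A)))).hom_inv_id
  have h : DerivedCategory.Plus.ι.map ((gammaStar k K).rightDerivedFunctorPlusUnit.app
        ((HomotopyCategory.Plus.singleFunctor (GMod k K) 0).obj (constG k K A))) ≫
      (RgammaStarIso k K A).hom = DerivedCategory.Q.map
        (((gammaStar k K).mapHomologicalComplex (ComplexShape.up ℤ)).map
          (constToCoindComplex k K A)) := by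
    refine ((Category.assoc _ _ _).symm.trans
      (congrArg (· ≫ (DerivedCategory.Plus.ι.mapIso
        (asIso ((gammaStar k K).rightDerivedFunctorPlusUnit.app (coindPlus k K A)))).inv)
        nat.symm)).trans ?_
    refine (Category.assoc _ _ _).trans ((congrArg (_ ≫ ·) hinv).trans ?_)
    exact Category.comp_id _
  refine (Category.assoc _ _ _).trans ?_
  refine (congrArg (_ ≫ ·) ((Category.assoc _ _ _).trans (congrArg (_ ≫ ·) h))).trans ?_
  rw [constToGammaComplex, Functor.map_comp, Functor.map_comp]
  rfl

end derived

end WeilEtale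

/-! ### Connecting maps of short exact sequences, with signs. -/

namespace CochainComplex

open CategoryTheory Limits HomologicalComplex HomComplex Pretriangulated

section

variable {C : Type*} [Category* C] [Abelian C]

lemma shiftFunctorCompIsoId_hom_app_f (K : CochainComplex C ℤ) (a b : ℤ) (h : a + b = 0) (n : ℤ) :
    ((shiftFunctorCompIsoId (CochainComplex C ℤ) a b h).hom.app K).f n =
      (K.XIsoOfEq (show n + b + a = n by lia)).hom := by
  refine (congrArg₂ (· ≫ ·) (shiftFunctorAdd'_inv_app_f' K a b 0 h n)
    (shiftFunctorZero_hom_app_f K n)).trans ?_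
  exact XIsoOfEq_hom_comp_XIsoOfEq_hom ..

/-- The first projection of the mapping cocone is the opposite of a shift of the third morphism of
the triangle of the mapping cone. -/
lemma shift_triangle_mor₃_comp {K L : CochainComplex C ℤ} (f : K ⟶ L) :
    (mappingCone.triangle f).mor₃⟦(-1 : ℤ)⟧' ≫
      (shiftFunctorCompIsoId (CochainComplex C ℤ) (1 : ℤ) (-1) (add_neg_cancel 1)).hom.app K =
        -mappingCocone.fst f := by
  ext n
  have h : (mappingCone.triangle f).mor₃.f (n + -1) ≫
      (K.XIsoOfEq (show n + -1 + 1 = n by lia)).hom = -(mappingCone.fst f).1.v (n + -1) n (by lia) := by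
    refine mappingCone.ext_from f n (n + -1) (by lia) ?_ ?_
    · refine (mappingCone.inl_v_triangle_mor₃_f_assoc f n (n + -1) rfl _).trans ?_
      rw [Preadditive.comp_neg, mappingCone.inl_v_fst_v]
      refine (Preadditive.neg_comp _ _).trans ?_
      exact congrArg Neg.neg (Iso.inv_hom_id (K.XIsoOfEq (show n + -1 + 1 = n by lia)))
    · refine (mappingCone.inr_f_triangle_mor₃_f_assoc f _ _).trans ?_
      rw [Preadditive.comp_neg, mappingCone.inr_f_fst_v, neg_zero]
      exact zero_comp
  refine (congrArg ((mappingCone.triangle f).mor₃.f (n + -1) ≫ ·)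
    (shiftFunctorCompIsoId_hom_app_f K 1 (-1) (add_neg_cancel 1) n)).trans (h.trans ?_)
  exact congrArg Neg.neg (mappingCocone_fst_f f n).symm

end

namespace TwoTerm

variable {C : Type*} [Category* C] [Abelian C]

/-- The complex `single 1 A` as a two-term complex. -/
noncomputable def single₁ (A : C) {Z : C} (hZ : IsZero Z) :
    TwoTerm ((HomologicalComplex.single C (ComplexShape.up ℤ) 1).obj A) (0 : Z ⟶ A) where
  iso₀ := (isZero_single_obj_X _ _ _ _ zero_ne_one).iso hZ
  iso₁ := singleObjXSelf _ _ _
  comm := by simp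
  isZero _ _ h := isZero_single_obj_X _ _ _ _ h

variable {K : CochainComplex C ℤ} {A₀ A₁ : C} {f : A₀ ⟶ A₁}

lemma isZero_X_of_isZero_zero (hK : TwoTerm K f) (h : IsZero A₀) : IsZero (K.X 0) :=
  h.of_iso hK.iso₀

lemma isZero_X_of_isZero_one (hK : TwoTerm K f) (h : IsZero A₁) : IsZero (K.X 1) :=
  h.of_iso hK.iso₁

/-- A two-term complex with zero differential is a direct sum of single complexes. -/
noncomputable def isoBiprodSingle (hK : TwoTerm K (0 : A₀ ⟶ A₁)) :
    K ≅ (HomologicalComplex.single C (ComplexShape.up ℤ) 0).obj A₀ ⊞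
      (HomologicalComplex.single C (ComplexShape.up ℤ) 1).obj A₁ :=
  let h₀ := TwoTerm.single A₀ (isZero_zero C)
  let h₁ := TwoTerm.single₁ A₁ (isZero_zero C)
  biprod.uniqueUpToIso _ _ (b :=
    { pt := K
      fst := hom hK h₀ (𝟙 _) 0 (by simp)
      snd := hom hK h₁ 0 (𝟙 _) (by simp)
      inl := hom h₀ hK (𝟙 _) 0 (by simp)
      inr := hom h₁ hK 0 (𝟙 _) (by simp)
      inl_fst := hom_ext h₀ (by simp [hom_f_zero])
        ((h₀.isZero_X_of_isZero_one (isZero_zero C)).eq_of_src _ _)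
      inl_snd := hom_ext h₀ (by simp [hom_f_zero]) (by simp [hom_f_one])
      inr_fst := hom_ext h₁ (by simp [hom_f_zero]) (by simp [hom_f_one])
      inr_snd := hom_ext h₁ ((h₁.isZero_X_of_isZero_zero (isZero_zero C)).eq_of_src _ _)
        (by simp [hom_f_one]) }) (isBinaryBilimitOfTotal _
      (hom_ext hK (by simp [hom_f_zero]) (by simp [hom_f_one])))

end TwoTerm

end CochainComplex

namespace DerivedCategory

open CategoryTheory Limits HomologicalComplex CochainComplex HomComplex Pretriangulated

variable {C : Type*} [Category* C] [Abelian C] [HasDerivedCategory C]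

/-- The comparison of the single functors on complexes and on the derived category has identity
components, so the shift isomorphisms agree up to the commutation of `Q` with shifts. -/
lemma singleFunctors_shiftIso_inv_app (n a a' : ℤ) (h : n + a = a') (X : C) :
    ((singleFunctors C).shiftIso n a a' h).inv.app X =
      Q.map (((CochainComplex.singleFunctors C).shiftIso n a a' h).inv.app X) ≫
        (Q.commShiftIso n).hom.app ((CochainComplex.singleFunctor C a').obj X) := by
  have h1 := NatTrans.congr_app ((singleFunctorsPostcompQIso C).hom.comm n a a' h) X
  rw [singleFunctorsPostcompQIso_hom_hom, singleFunctorsPostcompQIso_hom_hom] at h1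
  have h2 : ((singleFunctors C).shiftIso n a a' h).hom.app X =
      (((CochainComplex.singleFunctors C).postcomp Q).shiftIso n a a' h).hom.app X := by
    refine (Category.comp_id _).symm.trans (h1.trans ?_)
    refine (congrArg (· ≫ _) ((CategoryTheory.shiftFunctor _ n).map_id _)).trans ?_
    exact Category.id_comp _
  have h3 : ((singleFunctors C).shiftIso n a a' h).app X =
      (((CochainComplex.singleFunctors C).postcomp Q).shiftIso n a a' h).app X := Iso.ext h2
  exact (congrArg Iso.inv h3).trans (SingleFunctors.postcomp_shiftIso_inv_app ..)

lemma singleδ_eq {S : ShortComplex C} (hS : S.ShortExact) :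
    hS.singleδ = triangleOfSESδ (hS.map_of_exact (HomologicalComplex.single C (ComplexShape.up ℤ) 0)) := by
  have h1 := singleFunctorsPostcompQIso_hom_hom (C := C) 0
  have h2 := singleFunctorsPostcompQIso_inv_hom (C := C) 0
  have h1' := NatTrans.congr_app h1 S.X₃
  have h2' := NatTrans.congr_app h2 S.X₁
  have h3 := congrArg (fun a ↦ a ≫ triangleOfSESδ (hS.map_of_exact
    (HomologicalComplex.single C (ComplexShape.up ℤ) 0)) ≫
      ((singleFunctorsPostcompQIso C).inv.hom 0).app S.X₁⟦(1 : ℤ)⟧') h1'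
  have h4 := congrArg (fun b ↦ triangleOfSESδ (hS.map_of_exact
    (HomologicalComplex.single C (ComplexShape.up ℤ) 0)) ≫ b⟦(1 : ℤ)⟧') h2'
  refine h3.trans ((Category.id_comp _).trans (h4.trans ?_))
  refine (congrArg (_ ≫ ·) ((CategoryTheory.shiftFunctor _ (1 : ℤ)).map_id _)).trans ?_
  exact Category.comp_id _

end DerivedCategory

namespace CochainComplex

open CategoryTheory Limits HomologicalComplex HomComplex Pretriangulated

variable {C : Type*} [Category* C] [Abelian C]

lemma shift_descShortComplex_f (S : ShortComplex (CochainComplex C ℤ)) (n : ℤ) :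
    ((mappingCone.descShortComplex S)⟦(-1 : ℤ)⟧').f n =
      (mappingCocone.snd S.f).v n (n + -1) rfl ≫ S.g.f (n + -1) := by
  rw [mappingCocone_snd_v]
  refine (mappingCone.desc_f S.f 0 S.g (by simp) (n + -1) n (by lia)).trans ?_
  rw [Cochain.zero_v, comp_zero, zero_add]
  rfl

lemma singleFunctors_shiftIso_inv_app_f (n a a' : ℤ) (h : n + a = a') (X : C) (i : ℤ) :
    (((singleFunctors C).shiftIso n a a' h).inv.app X).f i = eqToHom (by
      change (if i = a then X else _) = (if i + n = a' then X else _)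
      rw [if_congr (show i = a ↔ i + n = a' by lia) rfl rfl]) := rfl

namespace TwoTerm

variable {K : CochainComplex C ℤ} {A₀ A₁ : C} {f : A₀ ⟶ A₁}

/-- The projection to the term in degree `0`. -/
noncomputable def toSingleZero (hK : TwoTerm K f) :
    K ⟶ (HomologicalComplex.single C (ComplexShape.up ℤ) 0).obj A₀ :=
  hom hK (.single A₀ (isZero_zero C)) (𝟙 _) 0 (by simp)

/-- The map to a single complex in degree `1` induced by a map from the term in degree `1`. -/
noncomputable def toSingleOne (hK : TwoTerm K f) {B : C} (g : A₁ ⟶ B) (h : f ≫ g = 0) :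
    K ⟶ (HomologicalComplex.single C (ComplexShape.up ℤ) 1).obj B :=
  hom hK (.single₁ B (isZero_zero C)) 0 g (by rw [h, comp_zero])

lemma toSingleZero_f (hK : TwoTerm K f) :
    (hK.toSingleZero).f 0 = hK.iso₀.hom ≫ (singleObjXSelf _ _ _).inv := by
  refine (hom_f_zero ..).trans ?_
  rw [Category.id_comp]
  rfl

lemma toSingleOne_f (hK : TwoTerm K f) {B : C} (g : A₁ ⟶ B) (h : f ≫ g = 0) :
    (hK.toSingleOne g h).f 1 = hK.iso₁.hom ≫ g ≫ (singleObjXSelf _ _ _).inv :=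
  hom_f_one ..

/-- The map from a two-term complex to the mapping cocone of its differential. -/
noncomputable def toMappingCocone (hK : TwoTerm K f) :
    K ⟶ mappingCocone ((HomologicalComplex.single C (ComplexShape.up ℤ) 0).map f) :=
  -- The minus sign is forced by the cocycle condition, in which the coboundary of the second
  -- component and the first component followed by the differential must add up to zero. It later
  -- cancels the sign in `shift_triangle_mor₃_comp`.
  mappingCocone.lift _ (-hK.toSingleZero)
    (Cochain.single (hK.iso₁.hom ≫ (singleObjXSelf (ComplexShape.up ℤ) 0 A₁).inv) (-1)) (by
      refine Cochain.ext _ _ fun p q hpq ↦ ?_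
      obtain rfl : p = q := by lia
      by_cases hp : p = 0
      · subst hp
        rw [Cochain.add_v, δ_v (-1) 0 (by lia) _ 0 0 _ (-1) 1 (by lia) (by lia)]
        simp only [single_obj_d, comp_zero, Cochain.single_v, Cochain.ofHom_v]
        rw [reassoc_of% hK.comm, comp_f, neg_f_apply, toSingleZero_f, single_map_f_self]
        simp
      · exact (isZero_single_obj_X _ _ _ _ hp).eq_of_tgt _ _)

end TwoTerm

lemma toMappingCocone_comp_shift_desc {S : ShortComplex C} {K : CochainComplex C ℤ}
    (hK : TwoTerm K S.f) :
    hK.toMappingCocone ≫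
      (mappingCone.descShortComplex
        (S.map (HomologicalComplex.single C (ComplexShape.up ℤ) 0)))⟦(-1 : ℤ)⟧' =
      hK.toSingleOne S.g S.zero ≫
        ((singleFunctors C).shiftIso (-1) 1 0 (neg_add_cancel 1)).inv.app S.X₃ := by
  refine hK.hom_ext ?_ ?_
  · exact (isZero_single_obj_X (ComplexShape.up ℤ) 0 S.X₃ (0 + -1) (by lia)).eq_of_tgt _ _
  · refine (congrArg (hK.toMappingCocone.f 1 ≫ ·) (shift_descShortComplex_f
      (S.map (HomologicalComplex.single C (ComplexShape.up ℤ) 0)) 1)).trans ?_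
    refine (mappingCocone.lift_f_snd_v_assoc _ _ _ _ _ _ _ _).trans ?_
    refine Eq.trans ?_ (congrArg₂ (· ≫ ·) (hK.toSingleOne_f S.g S.zero)
      (singleFunctors_shiftIso_inv_app_f (-1) 1 0 (neg_add_cancel 1) S.X₃ 1)).symm
    -- The degree `1 + -1` is replaced by a variable equal to `0`, so that the transports between
    -- equal objects reduce to `eqToHom`.
    have key (m : ℤ) (hm : 0 = m) : (Cochain.single
        (hK.iso₁.hom ≫ (singleObjXSelf (ComplexShape.up ℤ) 0 S.X₂).inv) (-1)).v 1 m (by lia) ≫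
          ((HomologicalComplex.single C (ComplexShape.up ℤ) 0).map S.g).f m =
        (hK.iso₁.hom ≫ S.g ≫ (singleObjXSelf (ComplexShape.up ℤ) 1 S.X₃).inv) ≫
          eqToHom (by
            subst hm
            exact (single_obj_X_self _ 1 S.X₃).trans (single_obj_X_self _ 0 S.X₃).symm) := by
      subst hm
      rw [Cochain.single_v, single_map_f_self]
      rw [Category.assoc, Category.assoc, Category.assoc, Iso.inv_hom_id_assoc]
      simp only [singleObjXSelf, singleObjXIsoOfEq, eqToIso.inv, eqToHom_trans]
    exact key (1 + -1) rfl

end CochainComplex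

namespace CategoryTheory.Functor

/-- For the application, `p` is the third map of a cone triangle and `d` the quasi-isomorphism from
the cone to the quotient; then `hδ` characterises the connecting map `δ`, and the identity is its
shift by `-1`, precomposed with `v`. -/
lemma map_shift_comp_shiftFunctorCompIsoId {C D : Type*} [Category* C] [Category* D] [HasShift C ℤ]
    [HasShift D ℤ] (F : C ⥤ D) [F.CommShift ℤ] {T X A B : C} (v : T ⟶ X⟦(-1 : ℤ)⟧)
    (p : X ⟶ A⟦(1 : ℤ)⟧) (d : X ⟶ B) (δ : F.obj B ⟶ (F.obj A)⟦(1 : ℤ)⟧)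
    (hδ : F.map d ≫ δ = F.map p ≫ (F.commShiftIso (1 : ℤ)).hom.app A) :
    F.map (v ≫ p⟦(-1 : ℤ)⟧' ≫
        (shiftFunctorCompIsoId C (1 : ℤ) (-1) (add_neg_cancel 1)).hom.app A) =
      F.map (v ≫ d⟦(-1 : ℤ)⟧') ≫ (F.commShiftIso (-1 : ℤ)).hom.app B ≫ δ⟦(-1 : ℤ)⟧' ≫
        (shiftFunctorCompIsoId D (1 : ℤ) (-1) (add_neg_cancel 1)).hom.app (F.obj A) := by
  have h := congrArg (fun a ↦ a⟦(-1 : ℤ)⟧') hδ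
  simp only [Functor.map_comp] at h
  simp only [Functor.map_comp, map_shiftFunctorCompIsoId_hom_app, Category.assoc,
    F.commShiftIso_hom_naturality_assoc]
  rw [reassoc_of% h]

end CategoryTheory.Functor

namespace DerivedCategory

open CategoryTheory Limits HomologicalComplex CochainComplex HomComplex Pretriangulated

variable {C : Type*} [Category* C] [Abelian C] [HasDerivedCategory C]

/-- For a short exact sequence `0 ⟶ X₁ ⟶ X₂ ⟶ X₃ ⟶ 0`, the connecting map `X₃[-1] ⟶ X₁` is given
by the projections of the complex `X₁ ⟶ X₂` to `X₃[-1]` and to `X₁`. -/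
lemma Q_map_toSingleZero {S : ShortComplex C} (hS : S.ShortExact) {K : CochainComplex C ℤ}
    (hK : TwoTerm K S.f) :
    Q.map hK.toSingleZero = Q.map (hK.toSingleOne S.g S.zero) ≫
      ((singleFunctors C).shiftIso (-1) 1 0 (neg_add_cancel 1)).inv.app S.X₃ ≫
      hS.singleδ⟦(-1 : ℤ)⟧' ≫
      (shiftFunctorCompIsoId (DerivedCategory C) (1 : ℤ) (-1) (add_neg_cancel 1)).hom.app
        ((singleFunctor C 0).obj S.X₁) := by
  set S' := S.map (HomologicalComplex.single C (ComplexShape.up ℤ) 0)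
  have hS' : S'.ShortExact := hS.map_of_exact _
  -- The sign in `toMappingCocone` and that of the cone triangle cancel, so the connecting map is
  -- the projection to degree 0 without sign.
  have h1 : hK.toMappingCocone ≫ (mappingCone.triangle S'.f).mor₃⟦(-1 : ℤ)⟧' ≫
      (shiftFunctorCompIsoId (CochainComplex C ℤ) (1 : ℤ) (-1) (add_neg_cancel 1)).hom.app S'.X₁ =
        hK.toSingleZero := by
    refine (congrArg (hK.toMappingCocone ≫ ·) (shift_triangle_mor₃_comp S'.f)).trans ?_
    refine (Preadditive.comp_neg _ _).trans ((congrArg Neg.neg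
      (mappingCocone.lift_fst ((HomologicalComplex.single C (ComplexShape.up ℤ) 0).map S.f) _ _ _)).trans ?_)
    exact neg_neg _
  have h2 := congrArg Q.map (toMappingCocone_comp_shift_desc hK)
  have h3 := Q.map_shift_comp_shiftFunctorCompIsoId hK.toMappingCocone
    (mappingCone.triangle S'.f).mor₃ _ _ (descShortComplex_triangleOfSESδ hS')
  refine (congrArg Q.map h1.symm).trans (h3.trans ?_)
  refine (congrArg (· ≫ _) (h2.trans (Q.map_comp _ _))).trans ?_
  rw [singleδ_eq, singleFunctors_shiftIso_inv_app]
  refine (Category.assoc _ _ _).trans (congrArg (_ ≫ ·) ?_)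
  exact (Category.assoc _ _ _).symm

end DerivedCategory

/-! ### The distinguished triangle `ℤ → ℤᶜ → ℚ[-1]` and its boundary. -/

namespace WeilEtale

open CategoryTheory Limits CochainComplex HomologicalComplex Pretriangulated

section

variable (k : Type v) (K : Type u) [Field k] [Fintype k] [Field K] [Algebra k K]
  [IsAlgClosed K] [Algebra.IsAlgebraic k K]

lemma constUnit_map_constToCoind_meanIntHom :
    constUnit k K ℤ ≫ (gammaStar k K).map (constToCoind k K ℤ) ≫ meanIntHom k K =
      constMap k K (Int.castAddHom ℚ) :=
  DiscMod.hom_ext k K fun n ↦ Per.meanInt_const (k := k) (K := K) n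

lemma toZc_f_zero : (toZc k K).f 0 =
    (singleObjXSelf (ComplexShape.up ℤ) 0 (const k K ℤ)).hom ≫ constMap k K (Int.castAddHom ℚ) ≫
      (twoTermZc k K).iso₀.inv :=
  mkHomFromSingle_f ..

lemma fromZc_f_one : (fromZc k K).f 1 = (twoTermZc k K).iso₁.hom ≫ extProj k K projQZ ≫
    (singleObjXSelf (ComplexShape.up ℤ) 1 (const k K ℚ)).inv :=
  (mkHomToSingle_f ..).trans (Category.assoc _ _ _)

lemma constToGammaComplex_f_zero (A : Type) [AddCommGroup A] : (constToGammaComplex k K A).f 0 =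
    (singleObjXSelf (ComplexShape.up ℤ) 0 (const k K A)).hom ≫ constUnit k K A ≫
      (gammaStar k K).map (constToCoind k K A) ≫ (gammaTwoTerm k K A).iso₀.inv := by
  have h : (((gammaStar k K).mapHomologicalComplex (ComplexShape.up ℤ)).map
      (constToCoindComplex k K A)).f 0 = _ := congrArg (gammaStar k K).map
    (TwoTerm.hom_f_zero (TwoTerm.single (constG k K A) (isZero_zero _)) (coindTwoTerm k K A)
    (constToCoind k K A) 0 (by rw [comp_zero, constToCoind_coindDiff]))
  rw [constToGammaComplex, comp_f, comp_f, h, single_map_f_self,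
    singleMapHomologicalComplex_inv_app_self, Functor.map_comp, Functor.map_comp]
  simp only [Category.assoc]
  refine congrArg (fun a ↦ _ ≫ constUnit k K A ≫ a) ?_
  exact Iso.map_inv_hom_id_assoc (singleObjXSelf (ComplexShape.up ℤ) 0 (constG k K A))
    (gammaStar k K) _

lemma constToGammaComplex_gammaComplexToZc :
    constToGammaComplex k K ℤ ≫ gammaComplexToZc k K = toZc k K := by
  refine (TwoTerm.single (const k K ℤ) (isZero_zero _)).hom_ext ?_
    ((isZero_single_obj_X _ _ _ _ one_ne_zero).eq_of_src _ _)
  rw [comp_f, constToGammaComplex_f_zero, gammaComplexToZc, TwoTerm.hom_f_zero, toZc_f_zero,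
    ← constUnit_map_constToCoind_meanIntHom]
  simp only [Category.assoc, Iso.inv_hom_id_assoc]

/-- The quotient `ℚ/ℤ ⟶ M` of `ℤᶜ` by `ℤ`. -/
noncomputable abbrev quotZc : CochainComplex (DiscMod k K) ℤ :=
  HomologicalComplex.double (extIncl k K projQZ) rel_zero_one

/-- `quotZc` as a two-term complex. -/
noncomputable def twoTermQuotZc : TwoTerm (quotZc k K) (extIncl k K projQZ) := .double _ _

/-- The projection from `ℤᶜ` to its quotient by `ℤ`. -/
noncomputable def ZcToQuotZc : Zc k K ⟶ quotZc k K :=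
  (twoTermZc k K).hom (twoTermQuotZc k K) (constMap k K projQZ) (𝟙 _) (Category.comp_id _)

lemma comp_inv_hom {C : Type*} [Category* C] {X A B E : C} (a : X ⟶ A) (b : A ⟶ B)
    (e : E ≅ B) : (a ≫ b ≫ e.inv) ≫ e.hom = a ≫ b := by
  simp

lemma comp_inv_hom_comp {C : Type*} [Category* C] {X A B E D : C} (a : X ⟶ A) (b : A ⟶ B)
    (e : E ≅ B) (c : B ⟶ D) : (a ≫ b ≫ e.inv) ≫ e.hom ≫ c = a ≫ b ≫ c := by
  simp

lemma ZcToQuotZc_f_zero : (ZcToQuotZc k K).f 0 =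
    (twoTermZc k K).iso₀.hom ≫ constMap k K projQZ ≫ (twoTermQuotZc k K).iso₀.inv :=
  TwoTerm.hom_f_zero ..

lemma ZcToQuotZc_f_one : (ZcToQuotZc k K).f 1 =
    (twoTermZc k K).iso₁.hom ≫ (twoTermQuotZc k K).iso₁.inv :=
  (TwoTerm.hom_f_one ..).trans (congrArg (_ ≫ ·) (Category.id_comp _))

/-- The sequence `0 → ℤ → ℤᶜ → ℤᶜ/ℤ → 0`. -/
noncomputable def seqZc : ShortComplex (CochainComplex (DiscMod k K) ℤ) :=
  ShortComplex.mk (toZc k K) (ZcToQuotZc k K) (by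
    refine (TwoTerm.single (const k K ℤ) (isZero_zero _)).hom_ext ?_
      ((isZero_single_obj_X _ _ _ _ one_ne_zero).eq_of_src _ _)
    have h : constMap k K (Int.castAddHom ℚ) ≫ constMap k K projQZ = 0 := (bocksteinSeq k K).zero
    refine (congrArg₂ (· ≫ ·) (toZc_f_zero k K) (ZcToQuotZc_f_zero k K)).trans ?_
    refine (comp_inv_hom_comp _ _ (twoTermZc k K).iso₀ _).trans ?_
    rw [reassoc_of% h]
    exact (congrArg (_ ≫ ·) zero_comp).trans comp_zero)

-- In degree 0 this is `0 → ℤ → ℚ → ℚ/ℤ → 0`, and in degree 1 it is the identity of `M`.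
open ZeroObject in
lemma seqZc_shortExact : (seqZc k K).ShortExact := by
  let T : ShortComplex (DiscMod k K) :=
    ShortComplex.mk (0 : (0 : DiscMod k K) ⟶ modM k K) (𝟙 (modM k K)) zero_comp
  have hT : T.ShortExact :=
    { exact := (T.exact_iff_mono rfl).2 (inferInstanceAs (Mono (𝟙 (modM k K))))
      mono_f := ⟨fun _ _ _ ↦ (isZero_zero (DiscMod k K)).eq_of_tgt _ _⟩
      epi_g := inferInstanceAs (Epi (𝟙 (modM k K))) }
  let φ : bocksteinSeq k K ⟶ T :=
    { τ₁ := 0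
      τ₂ := mapQM k K
      τ₃ := extIncl k K projQZ
      comm₁₂ := by
        refine zero_comp.trans (Eq.symm ?_)
        refine (Category.assoc _ _ _).symm.trans ?_
        exact (congrArg (· ≫ extIncl k K projQZ) (bocksteinSeq k K).zero).trans zero_comp
      comm₂₃ := Category.comp_id _ }
  refine TwoTerm.shortExact φ (TwoTerm.single (const k K ℤ) (isZero_zero _)) (twoTermZc k K)
    (twoTermQuotZc k K) ?_ ((isZero_single_obj_X _ _ _ _ one_ne_zero).eq_of_src _ _)
    (TwoTerm.hom_f_zero_iso₀ _ _ _ _ (Category.comp_id _))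
    (TwoTerm.hom_f_one_iso₁ _ _ _ _ (Category.comp_id _)) (bocksteinSeq_shortExact k K) hT
  exact (congrArg (· ≫ _) (toZc_f_zero k K)).trans (comp_inv_hom _ _ (twoTermZc k K).iso₀)

/-- The map from the quotient of `ℤᶜ` by `ℤ` to `ℚ[-1]`. -/
noncomputable abbrev quotZcToSingle :
    quotZc k K ⟶ (CochainComplex.singleFunctor (DiscMod k K) 1).obj (const k K ℚ) :=
  (twoTermQuotZc k K).toSingleOne (extProj k K projQZ) (extSeq k K projQZ).zero

lemma ZcToQuotZc_quotZcToSingle : ZcToQuotZc k K ≫ quotZcToSingle k K = fromZc k K := by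
  refine (twoTermZc k K).hom_ext ((isZero_single_obj_X _ _ _ _ zero_ne_one).eq_of_tgt _ _) ?_
  refine (congrArg₂ (· ≫ ·) (ZcToQuotZc_f_one k K) (TwoTerm.toSingleOne_f ..)).trans ?_
  rw [fromZc_f_one]
  simp only [Category.assoc, Iso.inv_hom_id_assoc]

/-- This is exactness of `0 → ℚ/ℤ → M → ℚ → 0`. -/
instance quasiIso_quotZcToSingle : QuasiIso (quotZcToSingle k K) := by
  refine TwoTerm.quasiIso (forgetDisc k K) (twoTermQuotZc k K)
    (TwoTerm.single₁ (const k K ℚ) (isZero_zero _)) _ 0 (extProj k K projQZ)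
    (TwoTerm.hom_f_zero_iso₀ ..) (TwoTerm.hom_f_one_iso₁ ..) ?_ ?_ ?_ ?_
  · intro x hx _
    exact congrArg Prod.fst hx
  · intro z _
    have := AddCommGrpCat.subsingleton_of_isZero ((forgetDisc k K).map_isZero (isZero_zero _))
    exact ⟨0, map_zero _, Subsingleton.elim _ _⟩
  · intro x y h
    refine ⟨x.1, Prod.ext rfl ?_⟩
    rw [Functor.map_zero] at h
    exact h.symm
  · intro z
    refine ⟨((0 : QZ), (z : ℚ)), 0, ?_⟩
    rw [map_zero, add_zero]
    rfl

/-- The morphism from `seqZc` to the sequence `0 → ℤ → ℚ → ℚ/ℤ → 0`. -/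
noncomputable def seqZcToBockstein :
    seqZc k K ⟶ (bocksteinSeq k K).map (HomologicalComplex.single _ (ComplexShape.up ℤ) 0) where
  τ₁ := 𝟙 _
  τ₂ := (twoTermZc k K).toSingleZero
  τ₃ := (twoTermQuotZc k K).toSingleZero
  comm₁₂ := by
    refine (TwoTerm.single (const k K ℤ) (isZero_zero _)).hom_ext ?_
      ((isZero_single_obj_X _ _ _ _ one_ne_zero).eq_of_src _ _)
    refine (congrFun (congrArg Hom.f (Category.id_comp ((bocksteinSeq k K).map
      (HomologicalComplex.single _ (ComplexShape.up ℤ) 0)).f)) 0).trans ?_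
    refine (single_map_f_self _ _ (constMap k K (Int.castAddHom ℚ))).trans ?_
    refine Eq.trans ?_ (congrArg₂ (· ≫ ·) (toZc_f_zero k K) (twoTermZc k K).toSingleZero_f).symm
    exact (comp_inv_hom_comp _ _ (twoTermZc k K).iso₀ _).symm
  comm₂₃ := by
    refine (twoTermZc k K).hom_ext ?_ ((isZero_single_obj_X _ _ _ _ one_ne_zero).eq_of_tgt _ _)
    refine (congrArg₂ (· ≫ ·) (twoTermZc k K).toSingleZero_f
      (single_map_f_self _ _ (constMap k K projQZ))).trans ?_
    refine Eq.trans ?_ (congrArg₂ (· ≫ ·) (ZcToQuotZc_f_zero k K)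
      (twoTermQuotZc k K).toSingleZero_f).symm
    refine Eq.trans ?_ (comp_inv_hom_comp _ _ (twoTermQuotZc k K).iso₀ _).symm
    refine (Category.assoc _ _ _).trans (congrArg (_ ≫ ·) ?_)
    exact Iso.inv_hom_id_assoc (singleObjXSelf (ComplexShape.up ℤ) 0 (const k K ℚ)) _

/-- The morphism from the extension `M` of `ℚ` to the extension `N ⊗ ℚ/ℤ` of `ℚ/ℤ`. -/
noncomputable def extSeqMap : extSeq k K projQZ ⟶ extSeq k K (AddMonoidHom.id QZ) where
  τ₁ := 𝟙 _
  τ₂ := ObjectProperty.homMk (mkHom ((AddMonoidHom.id QZ).prodMap projQZ) fun _ _ ↦ rfl)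
  τ₃ := constMap k K projQZ
  comm₁₂ := DiscMod.hom_ext k K fun _ ↦ Prod.ext rfl (map_zero projQZ).symm
  comm₂₃ := rfl

end

section derived

variable (k : Type v) (K : Type u) [Field k] [Fintype k] [Field K] [Algebra k K]
  [IsAlgClosed K] [Algebra.IsAlgebraic k K]

section

variable [HasDerivedCategory.{w₁} (GMod k K)] [HasDerivedCategory.{w₂} (DiscMod k K)]

/-- The isomorphism of `Rγ_* ℤ` with `ℤᶜ`. -/
noncomputable def RgammaStarIntIso :
    RgammaStarConst k K ℤ ≅ DerivedCategory.Q.obj (Zc k K) :=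
  RgammaStarIso k K ℤ ≪≫ asIso (DerivedCategory.Q.map (gammaComplexToZc k K))

lemma unitConst_RgammaStarIntIso :
    unitConst k K ℤ ≫ (RgammaStarIntIso k K).hom = toZcD k K := by
  rw [RgammaStarIntIso, Iso.trans_hom, ← Category.assoc, unitConst_RgammaStarIso]
  exact (DerivedCategory.Q.map_comp _ _).symm.trans
    (congrArg DerivedCategory.Q.map (constToGammaComplex_gammaComplexToZc k K))

lemma nonempty_RgammaStarRatIso :
    Nonempty (RgammaStarConst k K ℚ ≅
      (DerivedCategory.singleFunctor (DiscMod k K) 0).obj (const k K ℚ) ⊞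
        ((DerivedCategory.singleFunctor (DiscMod k K) 0).obj (const k K ℚ))⟦(-1 : ℤ)⟧) :=
  have := preservesBinaryBiproducts_of_preservesBiproducts
    (DerivedCategory.Q : CochainComplex (DiscMod k K) ℤ ⥤ _)
  ⟨RgammaStarIso k K ℚ ≪≫ asIso (DerivedCategory.Q.map (gammaComplexToDoubleQ k K)) ≪≫
    DerivedCategory.Q.mapIso (twoTermDoubleQ k K).isoBiprodSingle ≪≫
    DerivedCategory.Q.mapBiprod _ _ ≪≫
    biprod.mapIso (Iso.refl _) (((DerivedCategory.singleFunctors (DiscMod k K)).shiftIso (-1) 1 0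
      (neg_add_cancel 1)).symm.app (const k K ℚ))⟩

end

variable [HasDerivedCategory.{w₂} (DiscMod k K)]

/-- Naturality of the connecting map along `seqZcToBockstein`, which is the identity on `ℤ`. -/
lemma triangleOfSESδ_seqZc : DerivedCategory.triangleOfSESδ (seqZc_shortExact k K) =
    DerivedCategory.Q.map (twoTermQuotZc k K).toSingleZero ≫ bockstein k K := by
  have h := DerivedCategory.triangleOfSESδ_naturality (seqZc_shortExact k K)
    ((bocksteinSeq_shortExact k K).map_of_exact (HomologicalComplex.single _ (ComplexShape.up ℤ) 0))
    (seqZcToBockstein k K)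
  have h1 := (congrArg (fun a ↦ DerivedCategory.triangleOfSESδ (seqZc_shortExact k K) ≫ a⟦(1 : ℤ)⟧')
    (DerivedCategory.Q.map_id (seqZc k K).X₁)).symm.trans h
  refine Eq.trans ?_ (h1.trans ?_)
  · refine (Category.comp_id _).symm.trans (congrArg (_ ≫ ·) ?_)
    exact ((CategoryTheory.shiftFunctor _ (1 : ℤ)).map_id _).symm
  · exact congrArg (_ ≫ ·) (DerivedCategory.singleδ_eq (bocksteinSeq_shortExact k K)).symm

/-- Naturality of the connecting map along the pull-back square, which is the identity on the kernel
`ℚ/ℤ`. -/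
lemma singleδ_extSeq_projQZ : (extSeq_shortExact k K projQZ).singleδ =
    (DerivedCategory.singleFunctor (DiscMod k K) 0).map (constMap k K projQZ) ≫ eQZ k K := by
  have h := (ShortComplex.ShortExact.singleTriangle.map (extSeq_shortExact k K projQZ)
    (extSeq_shortExact k K (AddMonoidHom.id QZ)) (extSeqMap k K)).comm₃
  refine Eq.trans ?_ h
  refine (Category.comp_id _).symm.trans (congrArg (_ ≫ ·) ?_)
  refine ((CategoryTheory.shiftFunctor _ (1 : ℤ)).map_id _).symm.trans ?_
  exact congrArg (fun a ↦ a⟦(1 : ℤ)⟧')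
    ((DerivedCategory.singleFunctor (DiscMod k K) 0).map_id (const k K QZ)).symm

/-- The quotient of `ℤᶜ` by `ℤ` is `ℚ[-1]` in the derived category. -/
noncomputable def quotZcIso : DerivedCategory.Q.obj (quotZc k K) ≅
    ((DerivedCategory.singleFunctor (DiscMod k K) 0).obj (const k K ℚ))⟦(-1 : ℤ)⟧ :=
  asIso (DerivedCategory.Q.map (quotZcToSingle k K)) ≪≫
    ((DerivedCategory.singleFunctors (DiscMod k K)).shiftIso (-1) 1 0
      (neg_add_cancel 1)).symm.app (const k K ℚ)

/-- By `Q_map_toSingleZero`, the projection of `ℚ/ℤ → M` to degree 0 is the shifted connecting map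
of `M`, which is `e` restricted along `ℚ → ℚ/ℤ`; it remains to follow it by `β`. -/
lemma triangleOfSESδ_seqZc_eq_boundary : DerivedCategory.triangleOfSESδ (seqZc_shortExact k K) =
    (quotZcIso k K).hom ≫ boundary k K := by
  have h := DerivedCategory.Q_map_toSingleZero (extSeq_shortExact k K projQZ) (twoTermQuotZc k K)
  have h1 := (congrArg (fun a ↦ a⟦(-1 : ℤ)⟧') (singleδ_extSeq_projQZ k K)).trans
    (Functor.map_comp _ _ _)
  rw [triangleOfSESδ_seqZc]
  refine (congrArg (· ≫ bockstein k K) h).trans ?_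
  refine (congrArg (fun a ↦ (_ ≫ _ ≫ a ≫ _) ≫ bockstein k K) h1).trans ?_
  refine (Category.assoc _ _ _).trans ?_
  refine Eq.trans ?_ (Category.assoc _ _ _).symm
  refine congrArg (DerivedCategory.Q.map (quotZcToSingle k K) ≫ ·) ?_
  refine (Category.assoc _ _ _).trans (congrArg (_ ≫ ·) ?_)
  refine (Category.assoc _ _ _).trans ((Category.assoc _ _ _).trans ?_)
  rfl

lemma toZcD_distinguished :
    Triangle.mk (toZcD k K) (fromZcD k K) (boundary k K) ∈
      distTriang (DerivedCategory (DiscMod k K)) := by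
  refine isomorphic_distinguished _
    (DerivedCategory.triangleOfSES_distinguished (seqZc_shortExact k K)) _ (Iso.symm ?_)
  refine Triangle.isoMk _ _ (Iso.refl _) (Iso.refl _) (quotZcIso k K) ?_ ?_ ?_
  · exact (Category.comp_id _).trans (Category.id_comp _).symm
  · refine Eq.trans ?_ (Category.id_comp _).symm
    refine (Category.assoc _ _ _).symm.trans (congrArg (· ≫ _) ?_)
    exact (DerivedCategory.Q.map_comp _ _).symm.trans
      (congrArg DerivedCategory.Q.map (ZcToQuotZc_quotZcToSingle k K))
  · refine Eq.trans ?_ (triangleOfSESδ_seqZc_eq_boundary k K)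
    refine Eq.trans ?_ (Category.comp_id _)
    exact congrArg (_ ≫ ·) ((CategoryTheory.shiftFunctor _ (1 : ℤ)).map_id _)

end derived

end WeilEtale

open CategoryTheory Limits Pretriangulated

theorem theorem4p3 (k : Type v) (K : Type u) [Field k] [Fintype k] [Field K] [Algebra k K]
    [IsAlgClosed K] [Algebra.IsAlgebraic k K]
    [HasDerivedCategory.{w₁} (WeilEtale.GMod k K)]
    [HasDerivedCategory.{w₂} (WeilEtale.DiscMod k K)] :
    (∃ e : WeilEtale.RgammaStarConst k K ℤ ≅ DerivedCategory.Q.obj (WeilEtale.Zc k K),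
      WeilEtale.unitConst k K ℤ ≫ e.hom = WeilEtale.toZcD k K ∧
      Triangle.mk (WeilEtale.unitConst k K ℤ) (e.hom ≫ WeilEtale.fromZcD k K)
        (WeilEtale.boundary k K) ∈ distTriang (DerivedCategory (WeilEtale.DiscMod k K))) ∧
    Nonempty (WeilEtale.RgammaStarConst k K ℚ ≅
      (DerivedCategory.singleFunctor (WeilEtale.DiscMod k K) 0).obj (WeilEtale.const k K ℚ) ⊞
        ((DerivedCategory.singleFunctor (WeilEtale.DiscMod k K) 0).obj
          (WeilEtale.const k K ℚ))⟦(-1 : ℤ)⟧) := by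
  have h := WeilEtale.unitConst_RgammaStarIntIso k K
  refine ⟨⟨WeilEtale.RgammaStarIntIso k K, h, ?_⟩, WeilEtale.nonempty_RgammaStarRatIso k K⟩
  -- Only the middle vertex changes, along the isomorphism with `ℤᶜ`; its compatibility with the
  -- maps from `ℤ` is the first square.
  refine isomorphic_distinguished _ (WeilEtale.toZcD_distinguished k K) _
    (Triangle.isoMk _ _ (Iso.refl _) (WeilEtale.RgammaStarIntIso k K) (Iso.refl _) ?_ ?_ ?_)
  · exact h.trans (Category.id_comp _).symm
  · exact Category.comp_id _
  · refine Eq.trans ?_ (Category.id_comp _).symm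
    refine Eq.trans ?_ (Category.comp_id _)
    exact congrArg (_ ≫ ·) ((CategoryTheory.shiftFunctor _ (1 : ℤ)).map_id _)
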